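/- Conventions. For a ring $R$, a left module $M$ has the dual right module $M^*=\mathrm{Hom}_{\mathbb Z}(M,\mathbb Q/\mathbb Z)$, and $\mathcal S^*=\{M^*: M\in\mathcal S\}$. For a class $\mathcal X$ of right modules (closed under isomorphism), $\mathrm{Prod}(\mathcal X)$ is its closure under direct products and direct summands, $\mathrm{Prod}^+(\mathcal X)$ its closure under direct products and pure submodules, and $\mathrm{Pinj}(\mathcal X)$ the class of pure-injective modules in $\mathcal X$. A pair $(\mathcal S,\mathcal P)$ of classes of left, respectively right, $R$-modules is an almost dual pair if $\mathcal P=\mathrm{Prod}(\mathcal P)$, $\mathcal P$ is closed under pure-injective hulls, and $M\in\mathcal S\iff M^*\in\mathcal P$; it is a dual pair if moreover $\mathrm{Prod}(\mathcal S^*)=\mathrm{Pinj}(\mathcal P)$. Let $(R\text{-mod},\mathbf{Ab})$ be the category of additive functors from finitely presented left $R$-modules to abelian groups. A class of pure-injective right modules $\mathcal P=\mathrm{Prod}(\mathcal P)$ corresponds to the hereditary torsion theory on this category whose torsionfree class consists of the subobjects of the functors $N\otimes_R-$ with $N\in\mathcal P$; say that $\mathcal P$, and this torsion theory, arises from a dual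 pair if $\mathcal P=\mathrm{Pinj}(\mathcal P')$ for some dual pair $(\mathcal S,\mathcal P')$. Statement. Let $K$ be a field and $R=K\langle X,Y\rangle$ the free associative algebra. Then $R$ is a domain with no uniform left ideal and no uniform right ideal. The right module $R_R$ has an injective hull. For any injective hull $E$ of $R_R$ the following hold. 1. Neither $E$ nor any product $E^I$ of copies of $E$ has an indecomposable direct summand, and every nonzero submodule of $E^I$ contains a copy of $R_R$. 2. $(0,\mathrm{Prod}(E))$ is an almost dual pair. With $\mathcal S=0$ and $\mathcal P=\mathrm{Prod}(E)$, neither $\mathrm{Prod}(\mathcal S^*)\subseteq\mathcal P\subseteq\mathrm{Prod}^+(\mathcal S^*)$ nor $\mathrm{Prod}^+(\mathcal S^*)\subseteq\mathcal P\subseteq\mathrm{Prod}(\mathcal S^*)$ holds; moreover $\mathrm{Prod}(\mathcal S^*)\subsetneq\mathrm{Pinj}(\mathcal P)$. 3. $\mathrm{Prod}(E)$ consists of pure-injective modules, it is not of the form $\mathrm{Prod}(\mathcal S^*)$ for any class $\mathcal S$ of left $R$-modules, and it does not arise from a dual pair. The subobjects of the functors $N\otimes_R-$ with $N\in\mathrm{Prod}(E)$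 form the torsionfree class of a hereditary torsion theory on $(R\text{-mod},\mathbf{Ab})$, and this torsion theory does not arise from a dual pair. Consequently, over $R$: not every almost dual pair $(\mathcal S,\mathcal P)$ satisfies $\mathrm{Prod}(\mathcal S^*)\subseteq\mathcal P\subseteq\mathrm{Prod}^+(\mathcal S^*)$; not every class $\mathcal P=\mathrm{Prod}(\mathcal P)$ of pure-injective right modules arises from a dual pair; and not every hereditary torsion theory on $(R\text{-mod},\mathbf{Ab})$ arises from a dual pair. -/

import Mathlib

open CategoryTheory
open scoped TensorProduct MulOpposite

universe u v

noncomputable section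

/-! Left `R`-modules are `Module R M`; right `R`-modules are modules over `Rᵐᵒᵖ`,
with `x r = MulOpposite.op r • x`. -/

section ModuleNotions

variable (R : Type u) [Ring R]

/-- A uniform module: a nonzero module in which any two nonzero submodules meet nontrivially. -/
def IsUniformModule (M : Type v) [AddCommGroup M] [Module R M] : Prop :=
  Nontrivial M ∧ ∀ A B : Submodule R M, A ≠ ⊥ → B ≠ ⊥ → A ⊓ B ≠ ⊥

variable {R}

/-- `j : M → E` is an injective hull: `E` is injective and `j` is an essential embedding. -/
structure IsInjectiveHull {M : Type u} [AddCommGroup M] [Module R M]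
    {E : Type u} [AddCommGroup E] [Module R E] (j : M →ₗ[R] E) : Prop where
  inj : Module.Injective R E
  mono : Function.Injective j
  essential : ∀ N : Submodule R E, N ⊓ LinearMap.range j = ⊥ → N = ⊥

end ModuleNotions

section Tensor

variable (R : Type u) [Ring R]

/-- The relations `(n r) ⊗ a = n ⊗ (r a)` inside `N ⊗_ℤ A`. -/
def balancedRelations (N : Type u) [AddCommGroup N] [Module Rᵐᵒᵖ N]
    (A : Type u) [AddCommGroup A] [Module R A] : AddSubgroup (N ⊗[ℤ] A) :=
  AddSubgroup.closure
    {x | ∃ (n : N) (r : R) (a : A), x = (MulOpposite.op r • n) ⊗ₜ[ℤ] a - n ⊗ₜ[ℤ] (r • a)}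

/-- The abelian group `N ⊗_R A` for a right module `N` and a left module `A` over a
(not necessarily commutative) ring `R`. -/
abbrev BalancedTensor (N : Type u) [AddCommGroup N] [Module Rᵐᵒᵖ N]
    (A : Type u) [AddCommGroup A] [Module R A] : Type u :=
  (N ⊗[ℤ] A) ⧸ balancedRelations R N A

variable {R}
variable {N N' N'' : Type u} [AddCommGroup N] [Module Rᵐᵒᵖ N] [AddCommGroup N'] [Module Rᵐᵒᵖ N']
  [AddCommGroup N''] [Module Rᵐᵒᵖ N'']
variable {A A' A'' : Type u} [AddCommGroup A] [Module R A] [AddCommGroup A'] [Module R A']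
  [AddCommGroup A''] [Module R A'']

/-- The homomorphism `f ⊗ g : N ⊗_R A → N' ⊗_R A'`. -/
def BalancedTensor.map (f : N →ₗ[Rᵐᵒᵖ] N') (g : A →ₗ[R] A') :
    BalancedTensor R N A →+ BalancedTensor R N' A' :=
  QuotientAddGroup.map _ _
    (TensorProduct.map f.toAddMonoidHom.toIntLinearMap
      g.toAddMonoidHom.toIntLinearMap).toAddMonoidHom (by
    rw [balancedRelations, AddSubgroup.closure_le]
    rintro _ ⟨n, r, a, rfl⟩
    refine AddSubgroup.subset_closure ⟨f n, r, g a, ?_⟩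
    simp)

theorem BalancedTensor.map_mk_tmul (f : N →ₗ[Rᵐᵒᵖ] N') (g : A →ₗ[R] A') (n : N) (a : A) :
    BalancedTensor.map f g (QuotientAddGroup.mk (n ⊗ₜ[ℤ] a)) =
      QuotientAddGroup.mk (f n ⊗ₜ[ℤ] g a) := rfl

theorem BalancedTensor.hom_ext {B : Type u} [AddCommGroup B] {φ ψ : BalancedTensor R N A →+ B}
    (h : ∀ (n : N) (a : A), φ (QuotientAddGroup.mk (n ⊗ₜ[ℤ] a)) =
      ψ (QuotientAddGroup.mk (n ⊗ₜ[ℤ] a))) : φ = ψ := by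
  refine DFunLike.ext _ _ fun x => ?_
  obtain ⟨x, rfl⟩ := QuotientAddGroup.mk_surjective x
  induction x using TensorProduct.induction_on with
  | zero => simp
  | tmul n a => exact h n a
  | add x y hx hy => rw [QuotientAddGroup.mk_add, map_add, map_add, hx, hy]

end Tensor

section RightModules

variable {R : Type u} [Ring R]

/-- The finitely presented left modules. -/
abbrev isFP (R : Type u) [Ring R] : ObjectProperty (ModuleCat.{u} R) :=
  fun A => Module.FinitePresentation R A

/-- A pure embedding of right modules: an embedding that stays injective after tensoring with
any finitely presented left module (equivalently with any left module, because tensor products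
commute with direct limits). -/
def IsPureEmbedding {M N : ModuleCat.{u} Rᵐᵒᵖ} (f : M ⟶ N) : Prop :=
  Function.Injective f.hom ∧
    ∀ A : ModuleCat.{u} R, isFP R A →
      Function.Injective (BalancedTensor.map (R := R) f.hom (LinearMap.id : A →ₗ[R] A))

/-- Pure-injective right modules: those injective with respect to all pure embeddings. -/
def isPureInjective (R : Type u) [Ring R] : ObjectProperty (ModuleCat.{u} Rᵐᵒᵖ) :=
  fun N => ∀ ⦃A B : ModuleCat.{u} Rᵐᵒᵖ⦄ (f : A ⟶ B), IsPureEmbedding f →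
    ∀ g : A ⟶ N, ∃ h : B ⟶ N, f ≫ h = g

/-- `f : M ⟶ H` is a pure-injective hull of `M`: a pure-essential pure embedding into a
pure-injective module. -/
structure IsPureInjectiveHull {M H : ModuleCat.{u} Rᵐᵒᵖ} (f : M ⟶ H) : Prop where
  pureInjective : isPureInjective R H
  pure : IsPureEmbedding f
  essential : ∀ ⦃X : ModuleCat.{u} Rᵐᵒᵖ⦄ (g : H ⟶ X), IsPureEmbedding (f ≫ g) →
    Function.Injective g.hom

/-- `Prod(𝒳)`: the closure of `𝒳` under direct products and direct summands
(and isomorphism, an isomorphic copy being a direct summand). -/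
inductive prodClosure (X : ObjectProperty (ModuleCat.{u} Rᵐᵒᵖ)) :
    ObjectProperty (ModuleCat.{u} Rᵐᵒᵖ)
  | of (M : ModuleCat.{u} Rᵐᵒᵖ) : X M → prodClosure X M
  | pi {ι : Type u} (N : ι → ModuleCat.{u} Rᵐᵒᵖ) :
      (∀ i, prodClosure X (N i)) → prodClosure X (ModuleCat.of Rᵐᵒᵖ (∀ i, N i))
  | summand {M N : ModuleCat.{u} Rᵐᵒᵖ} : Retract M N → prodClosure X N → prodClosure X M

/-- `Prod⁺(𝒳)`: the closure of `𝒳` under direct products and pure submodules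
(and isomorphism, an isomorphism being a pure embedding). -/
inductive prodPlusClosure (X : ObjectProperty (ModuleCat.{u} Rᵐᵒᵖ)) :
    ObjectProperty (ModuleCat.{u} Rᵐᵒᵖ)
  | of (M : ModuleCat.{u} Rᵐᵒᵖ) : X M → prodPlusClosure X M
  | pi {ι : Type u} (N : ι → ModuleCat.{u} Rᵐᵒᵖ) :
      (∀ i, prodPlusClosure X (N i)) → prodPlusClosure X (ModuleCat.of Rᵐᵒᵖ (∀ i, N i))
  | pureSub {M N : ModuleCat.{u} Rᵐᵒᵖ} (f : M ⟶ N) : IsPureEmbedding f →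
      prodPlusClosure X N → prodPlusClosure X M

/-- `Prod(E)` for a single right module `E`. -/
def prodOf (E : ModuleCat.{u} Rᵐᵒᵖ) : ObjectProperty (ModuleCat.{u} Rᵐᵒᵖ) :=
  prodClosure fun M => Nonempty (M ≅ E)

/-- `Pinj(𝒳)`: the pure-injective modules in `𝒳`. -/
def pinj (X : ObjectProperty (ModuleCat.{u} Rᵐᵒᵖ)) : ObjectProperty (ModuleCat.{u} Rᵐᵒᵖ) :=
  fun M => X M ∧ isPureInjective R M

/-- The right module structure on `Hom_ℤ(M, ℚ/ℤ)` for a left module `M`: `(f r) m = f (r m)`. -/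
instance dualRightModule (M : Type u) [AddCommGroup M] [Module R M] :
    Module Rᵐᵒᵖ (CharacterModule M) where
  smul r f := AddMonoidHom.comp (show M →+ AddCircle (1 : ℚ) from f)
    (DistribSMul.toAddMonoidHom M r.unop)
  one_smul f := CharacterModule.ext _ fun m => congrArg f (one_smul R m)
  mul_smul r s f := CharacterModule.ext _ fun m => congrArg f (mul_smul s.unop r.unop m)
  smul_zero _ := rfl
  smul_add _ _ _ := rfl
  add_smul r s f := CharacterModule.ext _ fun m =>
    (congrArg f (add_smul r.unop s.unop m)).trans (map_add f _ _)
  zero_smul f := CharacterModule.ext _ fun m => (congrArg f (zero_smul R m)).trans (map_zero f)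

theorem dualRightModule_smul_apply (M : Type u) [AddCommGroup M] [Module R M]
    (r : Rᵐᵒᵖ) (f : CharacterModule M) (m : M) : (r • f) m = f (r.unop • m) := rfl

/-- The dual right module `M* = Hom_ℤ(M, ℚ/ℤ)` of a left module `M`. -/
def dualModule (M : ModuleCat.{u} R) : ModuleCat.{u} Rᵐᵒᵖ :=
  ModuleCat.of Rᵐᵒᵖ (CharacterModule M)

/-- `𝒮* = {M* : M ∈ 𝒮}`, up to isomorphism. -/
def dualClass (S : ObjectProperty (ModuleCat.{u} R)) : ObjectProperty (ModuleCat.{u} Rᵐᵒᵖ) :=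
  fun N => ∃ M, S M ∧ Nonempty (N ≅ dualModule M)

/-- Almost dual pairs: `𝒫 = Prod(𝒫)`, `𝒫` is closed under pure-injective hulls, and
`M ∈ 𝒮` iff `M* ∈ 𝒫`. -/
structure IsAlmostDualPair (S : ObjectProperty (ModuleCat.{u} R))
    (P : ObjectProperty (ModuleCat.{u} Rᵐᵒᵖ)) : Prop where
  prod_eq : P = prodClosure P
  hull : ∀ ⦃M H : ModuleCat.{u} Rᵐᵒᵖ⦄ (f : M ⟶ H), P M → IsPureInjectiveHull f → P H
  mem_iff : ∀ M : ModuleCat.{u} R, S M ↔ P (dualModule M)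

/-- Dual pairs: almost dual pairs with `Prod(𝒮*) = Pinj(𝒫)`. -/
def IsDualPair (S : ObjectProperty (ModuleCat.{u} R))
    (P : ObjectProperty (ModuleCat.{u} Rᵐᵒᵖ)) : Prop :=
  IsAlmostDualPair S P ∧ prodClosure (dualClass S) = pinj P

/-- The class of zero modules. -/
def zeroClass (R : Type u) [Ring R] : ObjectProperty (ModuleCat.{u} R) :=
  fun M => Limits.IsZero M

end RightModules

section FunctorCategory

variable (R : Type u) [Ring R]

/-- The functor category `(R-mod, Ab)`: additive functors from the finitely presented left
modules to abelian groups. -/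
abbrev FPFunctorCat : Type (u + 1) := (isFP R).FullSubcategory ⥤+ AddCommGrpCat.{u}

variable {R}

/-- The functor `N ⊗_R -` on finitely presented left modules, as a plain functor. -/
def tensorFunctorAux (N : ModuleCat.{u} Rᵐᵒᵖ) :
    (isFP R).FullSubcategory ⥤ AddCommGrpCat.{u} where
  obj A := AddCommGrpCat.of (BalancedTensor R N A.obj)
  map g := AddCommGrpCat.ofHom (BalancedTensor.map (LinearMap.id : N →ₗ[Rᵐᵒᵖ] N) g.hom.hom)
  map_id A := by
    ext1
    exact BalancedTensor.hom_ext fun n a => rfl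
  map_comp f g := by
    ext1
    exact BalancedTensor.hom_ext fun n a => rfl

instance (N : ModuleCat.{u} Rᵐᵒᵖ) : (tensorFunctorAux N).Additive where
  map_add {A B f g} := by
    ext1
    refine BalancedTensor.hom_ext fun n a => ?_
    change QuotientAddGroup.mk (n ⊗ₜ[ℤ] (f.hom.hom a + g.hom.hom a)) =
      (QuotientAddGroup.mk (n ⊗ₜ[ℤ] f.hom.hom a + n ⊗ₜ[ℤ] g.hom.hom a) :
        BalancedTensor R N B.obj)
    rw [TensorProduct.tmul_add]

/-- The object `N ⊗_R -` of the functor category `(R-mod, Ab)`. -/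
def tensorFunctor (N : ModuleCat.{u} Rᵐᵒᵖ) : FPFunctorCat R :=
  AdditiveFunctor.of (tensorFunctorAux N)

/-- A hereditary torsion theory: classes `T` (torsion) and `F` (torsionfree) which are exactly each
other's orthogonals with respect to `Hom`, with `T` closed under subobjects. -/
structure IsHereditaryTorsionTheory (T F : ObjectProperty (FPFunctorCat R)) : Prop where
  torsion_iff : ∀ X, T X ↔ ∀ Y, F Y → ∀ f : X ⟶ Y, f = 0
  torsionfree_iff : ∀ Y, F Y ↔ ∀ X, T X → ∀ f : X ⟶ Y, f = 0
  hereditary : ∀ ⦃X Y : FPFunctorCat R⦄ (f : X ⟶ Y), Mono f → T Y → T X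

/-- The class of functors cogenerated by a class `𝒫` of right modules closed under products:
the subobjects of the functors `N ⊗_R -` with `N ∈ 𝒫`. For `𝒫 = Prod(𝒫)` a class of
pure-injectives this is the torsionfree class of the hereditary torsion theory
corresponding to `𝒫`. -/
def cogeneratedClass (P : ObjectProperty (ModuleCat.{u} Rᵐᵒᵖ)) :
    ObjectProperty (FPFunctorCat R) :=
  fun G => ∃ N, P N ∧ ∃ i : G ⟶ tensorFunctor N, Mono i

end FunctorCategory

end

/-!
Write `R = K⟨X, Y⟩`, let `E` be an injective hull of `R_R`, and write `A* = Hom(A, R)` for a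
finitely presented left module `A`. Everything rests on the fact that no nonzero left module `M`
has its character dual in `Prod(E)`
(`IsInjectiveHull.subsingleton_of_prodOf_dualModule`). Modules in `Prod(E)` are injective and have
no elements annihilated by an essential right ideal `D`. So, if the dual of `M` is such a module,
then `M = D M` for all these `D`, and injectivity of the dual makes `X M + Y M` a direct sum of two
copies of `M`. With `D = X R + Y R` this gives `M = X M ⊕ Y M`. A nonzero element of `M` therefore
has nonzero coordinates along some infinite word, whereas the essential right ideal generated by
the words that leave this infinite word forces almost all of these coordinates to vanish.

Consequently a class `Prod(𝒮*)` contained in `Prod(E)` consists of zero modules, which gives the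
assertions about pairs of classes, because `E` is nonzero.

For the functor category, `N ⊗_R A = Hom(A*, N)` when `N` is injective and `A` finitely presented
(`BalancedTensor.exists_contract_eq`, `BalancedTensor.eq_zero_of_contract`). So morphisms
`F → N ⊗_R -` are homomorphisms `F(R) → N` (`FPFunctorCat.exists_toAtRing_eq`), and `N ⊗_R -` is an
injective object. Hence the subobjects of the functors `N ⊗_R -` with `N ∈ Prod(E)` are the
functors whose elements are detected by homomorphisms `F(R) → E`, and they form a hereditary
torsionfree class. As morphisms between functors `N ⊗_R -` come from homomorphisms of modules
(`FPFunctorCat.exists_isPureEmbedding`), this class still remembers which duals lie in `Prod(E)`.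

Decompositions of injective modules come from `Submodule.exists_isCompl_of_injective`: independent
submodules `B` and `D` lie in complementary summands, and the one containing `B` is essential over
it. This provides the injective hull, and it splits every nonzero summand of a product of copies
of `E`, because such a summand contains a copy of `R ⊇ X R ⊕ Y R`.
-/

noncomputable section

/-! ### Complements and essential extensions in injective modules -/

section Complements

variable {A : Type*} [Ring A]

/-- A submodule disjoint from `B` can be enlarged to one that is maximal with this property. -/
theorem Submodule.exists_maximal_disjoint {Q : Type*} [AddCommGroup Q] [Module A Q]
    {B D : Submodule A Q} (h : Disjoint B D) :
    ∃ C, D ≤ C ∧ Maximal (fun C => Disjoint B C) C := by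
  refine zorn_le_nonempty₀ {C | Disjoint B C} (fun c hc hchain y hy => ?_) D h
  exact ⟨sSup c, hchain.directedOn.disjoint_sSup_right.2 fun b hb => hc hb,
    fun z hz => le_sSup hz⟩

/-- In an injective module, disjoint submodules `B` and `D` are separated by a direct sum
decomposition `P ⊕ C` in which `P` is an essential extension of `B`. Here `C` is maximal
among the submodules disjoint from `B`, and `P` among those disjoint from `C`. -/
theorem Submodule.exists_isCompl_of_injective {Q : Type*} [AddCommGroup Q] [Module A Q]
    [Module.Injective A Q] {B D : Submodule A Q} (h : Disjoint B D) :
    ∃ P C : Submodule A Q, B ≤ P ∧ D ≤ C ∧ IsCompl P C ∧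
      ∀ N ≤ P, Disjoint N B → N = ⊥ := by
  obtain ⟨C, hDC, hC⟩ := exists_maximal_disjoint h
  obtain ⟨P, hBP, hP⟩ := exists_maximal_disjoint hC.prop.symm
  have hPC : Disjoint P C := hP.prop.symm
  -- `C` is also maximal among the submodules disjoint from `P`.
  have hmax : ∀ C', C ≤ C' → Disjoint P C' → C' ≤ C := fun C' h1 h2 =>
    hC.le_of_ge (h2.mono_left hBP) h1
  refine ⟨P, C, hBP, hDC, ⟨hPC, ?_⟩, fun N hN hNB => ?_⟩
  · let f : P →ₗ[A] Q ⧸ C := C.mkQ.comp P.subtype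
    have hf : Function.Injective f := by
      rw [← LinearMap.ker_eq_bot, LinearMap.ker_eq_bot']
      intro x hx
      have hxC : (x : Q) ∈ C := by simpa [f] using hx
      exact Subtype.ext (Submodule.disjoint_def.1 hPC x x.2 hxC)
    obtain ⟨g, hg⟩ := Module.Injective.out f hf P.subtype
    -- `P` is essential in `Q ⧸ C`, so the extension `g` of the inclusion is injective.
    have hess : ∀ L : Submodule A (Q ⧸ C), (∀ x : P, f x ∈ L → x = 0) → L = ⊥ := by
      intro L hL
      have hle : L.comap C.mkQ ≤ C := by
        refine hmax _ (fun x hx => ?_) (Submodule.disjoint_def.2 fun x hx hx' => ?_)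
        · have : C.mkQ x = 0 := by simpa using hx
          rw [Submodule.mem_comap, this]
          exact L.zero_mem
        · exact congrArg Subtype.val (hL ⟨x, hx⟩ hx')
      rw [eq_bot_iff]
      intro y hy
      obtain ⟨x, rfl⟩ := C.mkQ_surjective y
      have : x ∈ C := hle hy
      simpa using this
    have hginj : ∀ y, g y = 0 → y = 0 := by
      have := hess (LinearMap.ker g) fun x hx => by
        rw [LinearMap.mem_ker, hg] at hx
        exact Subtype.ext hx
      intro y hy
      have hy' : y ∈ LinearMap.ker g := hy
      rw [this] at hy'
      exact hy'
    have hrange : LinearMap.range g ≤ P := by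
      refine hP.le_of_ge (Submodule.disjoint_def.2 ?_) fun x hx => ⟨f ⟨x, hx⟩, hg _⟩
      rintro _ hxC ⟨y, rfl⟩
      have : C.comap g = ⊥ := hess _ fun x hx => by
        rw [Submodule.mem_comap, hg] at hx
        exact Subtype.ext (Submodule.disjoint_def.1 hPC x x.2 hx)
      have hy : y ∈ C.comap g := hxC
      rw [this] at hy
      rw [(Submodule.mem_bot A).1 hy, map_zero]
    rw [codisjoint_iff, eq_top_iff]
    intro q _
    let p : P := ⟨g (C.mkQ q), hrange ⟨_, rfl⟩⟩
    have h1 : g (C.mkQ q - f p) = 0 := by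
      rw [map_sub, hg]
      exact sub_self _
    have h2 : q - p ∈ C := by
      have h3 : C.mkQ (q - p) = 0 := by
        rw [map_sub]
        exact hginj _ h1
      rwa [Submodule.mkQ_apply, Submodule.Quotient.mk_eq_zero] at h3
    rw [← add_sub_cancel (p : Q) q]
    exact Submodule.add_mem_sup p.2 h2
  · have hdis : Disjoint B (C ⊔ N) := by
      refine Submodule.disjoint_def.2 fun b hb hb' => ?_
      obtain ⟨c, hc, n, hn, rfl⟩ := Submodule.mem_sup.1 hb'
      have hcP : c ∈ P := by
        have := P.sub_mem (hBP hb) (hN hn)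
        rwa [add_sub_cancel_right] at this
      have hc0 : c = 0 := Submodule.disjoint_def.1 hPC c hcP hc
      rw [hc0, zero_add] at hb ⊢
      exact Submodule.disjoint_def.1 hNB n hn hb
    have hNC : N ≤ C := le_sup_right.trans (hC.le_of_ge hdis le_sup_left)
    exact disjoint_self.1 (hPC.mono hN hNC)

/-- A retract of an injective module is injective. -/
theorem Module.Injective.of_retract {P Q : Type v} [AddCommGroup Q] [Module A Q]
    [AddCommGroup P] [Module A P] [Module.Injective A Q]
    (i : P →ₗ[A] Q) (r : Q →ₗ[A] P) (h : ∀ x, r (i x) = x) : Module.Injective A P where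
  out X Y _ _ _ _ f hf g := by
    obtain ⟨k, hk⟩ := Module.Injective.out f hf (i.comp g)
    exact ⟨r.comp k, fun x => by simp [hk, h]⟩

/-- Injectivity of modules passes through isomorphisms and retracts in `ModuleCat`. -/
theorem CategoryTheory.Retract.moduleInjective {M N : ModuleCat.{v} A} (h : Retract M N)
    [Module.Injective A N] : Module.Injective A M :=
  .of_retract h.i.hom h.r.hom fun x => congr($(h.retract).hom x)

end Complements

section Hulls

variable {A : Type u} [Ring A]

/-- A submodule of an injective module has an injective hull: the essential summand above it. -/
theorem exists_isInjectiveHull (M : Type u) [AddCommGroup M] [Module A M] :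
    ∃ (E : ModuleCat.{u} A) (j : M →ₗ[A] E), IsInjectiveHull j := by
  obtain ⟨Q, hQ, f, hf⟩ : ∃ Q : ModuleCat.{u} A, Module.Injective A Q ∧
      ∃ f : M →ₗ[A] Q, Function.Injective f := by
    let X := ModuleCat.of A M
    refine ⟨Injective.under X, ?_, (Injective.ι X).hom, ?_⟩
    · exact (Module.injective_iff_injective_object A _).2
        (inferInstanceAs (Injective (Injective.under X)))
    · exact (ModuleCat.mono_iff_injective (Injective.ι X)).1 inferInstance
  obtain ⟨P, C, hP, -, hPC, hess⟩ :=
    Submodule.exists_isCompl_of_injective (B := LinearMap.range f) (D := ⊥) disjoint_bot_right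
  refine ⟨ModuleCat.of A P, f.codRestrict P fun x => hP ⟨x, rfl⟩, ?_, ?_, ?_⟩
  · exact .of_retract P.subtype (P.projectionOnto C hPC)
      fun x => Submodule.projectionOnto_apply_left hPC x
  · exact fun x y h => hf congr(P.subtype $h)
  · intro N hN
    have := hess (N.map P.subtype) (Submodule.map_subtype_le P N) (by
      refine Submodule.disjoint_def.2 ?_
      rintro _ ⟨y, hy, rfl⟩ ⟨m, hm⟩
      have : y ∈ N ⊓ LinearMap.range (f.codRestrict P fun x => hP ⟨x, rfl⟩) :=
        ⟨hy, m, Subtype.ext hm⟩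
      rw [hN] at this
      rw [(Submodule.mem_bot A).1 this, map_zero])
    exact Submodule.map_injective_of_injective P.subtype_injective
      (this.trans (Submodule.map_bot _).symm)

theorem IsInjectiveHull.exists_smul_eq {M E : Type u} [AddCommGroup M] [Module A M]
    [AddCommGroup E] [Module A E] {j : M →ₗ[A] E} (hj : IsInjectiveHull j) {e : E} (he : e ≠ 0) :
    ∃ (a : A) (m : M), m ≠ 0 ∧ a • e = j m := by
  by_contra! h
  refine he ((Submodule.span_singleton_eq_bot (R := A)).1 (hj.essential _ ?_))
  rw [eq_bot_iff]
  rintro _ ⟨hx, m, rfl⟩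
  obtain ⟨a, ha⟩ := Submodule.mem_span_singleton.1 hx
  by_cases hm : m = 0
  · simp [hm]
  · exact absurd ha (h a m hm)

/-- An injective module containing two independent nonzero submodules is decomposable. -/
theorem not_indecomposable_of_disjoint {N : ModuleCat.{v} A} [Module.Injective A N]
    {B D : Submodule A N} (hB : B ≠ ⊥) (hD : D ≠ ⊥) (h : Disjoint B D) :
    ¬ Indecomposable N := by
  rintro ⟨-, hN⟩
  obtain ⟨P, C, hBP, hDC, hPC, -⟩ := Submodule.exists_isCompl_of_injective h
  have e : N ≅ ModuleCat.of A P ⊞ ModuleCat.of A C :=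
    (Submodule.prodEquivOfIsCompl P C hPC).symm.toModuleIso ≪≫
      (ModuleCat.biprodIsoProd (ModuleCat.of A P) (ModuleCat.of A C)).symm
  rcases hN _ _ e with h | h
  · rw [ModuleCat.isZero_iff_subsingleton] at h
    exact hB (eq_bot_iff.2 (hBP.trans (Submodule.subsingleton_iff_eq_bot.1 h).le))
  · rw [ModuleCat.isZero_iff_subsingleton] at h
    exact hD (eq_bot_iff.2 (hDC.trans (Submodule.subsingleton_iff_eq_bot.1 h).le))

end Hulls

/-! ### The closures `Prod` and `Prod⁺` -/

section Closures

variable {R : Type u} [Ring R]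

theorem prodClosure_idem (X : ObjectProperty (ModuleCat.{u} Rᵐᵒᵖ)) :
    prodClosure (prodClosure X) = prodClosure X := by
  refine le_antisymm (fun M hM => ?_) fun M hM => .of M hM
  induction hM with
  | of M h => exact h
  | pi N _ ih => exact .pi N ih
  | summand r _ ih => exact .summand r ih

theorem subsingleton_of_prodClosure {X : ObjectProperty (ModuleCat.{u} Rᵐᵒᵖ)}
    (hX : ∀ M, X M → Subsingleton M) {M : ModuleCat.{u} Rᵐᵒᵖ} (hM : prodClosure X M) :
    Subsingleton M := by
  induction hM with
  | of M h => exact hX M h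
  | pi N _ ih => exact inferInstanceAs (Subsingleton (∀ i, N i))
  | summand r _ ih =>
    exact Function.Injective.subsingleton (f := r.i.hom) fun x y h => by
      have := congrArg r.r.hom h
      rwa [← LinearMap.comp_apply, ← LinearMap.comp_apply, ← ModuleCat.hom_comp, r.retract] at this

theorem subsingleton_of_prodPlusClosure {X : ObjectProperty (ModuleCat.{u} Rᵐᵒᵖ)}
    (hX : ∀ M, X M → Subsingleton M) {M : ModuleCat.{u} Rᵐᵒᵖ} (hM : prodPlusClosure X M) :
    Subsingleton M := by
  induction hM with
  | of M h => exact hX M h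
  | pi N _ ih => exact inferInstanceAs (Subsingleton (∀ i, N i))
  | pureSub f hf _ ih => exact hf.1.subsingleton

variable {E : ModuleCat.{u} Rᵐᵒᵖ}

theorem prodOf_self : prodOf E E := .of E ⟨Iso.refl E⟩

theorem prodOf_pi (ι : Type u) : prodOf E (ModuleCat.of Rᵐᵒᵖ (ι → E)) :=
  .pi _ fun _ => prodOf_self

theorem prodOf_of_subsingleton {M : ModuleCat.{u} Rᵐᵒᵖ} [Subsingleton M] : prodOf E M :=
  .summand { i := 0, r := 0, retract := by ext; exact Subsingleton.elim _ _ } (prodOf_pi PEmpty)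

theorem prodOf_injective [Module.Injective Rᵐᵒᵖ E] {M : ModuleCat.{u} Rᵐᵒᵖ} (hM : prodOf E M) :
    Module.Injective Rᵐᵒᵖ M := by
  induction hM with
  | of M h => exact (Retract.ofIso h.some).moduleInjective
  | pi N _ ih => exact inferInstanceAs (Module.Injective Rᵐᵒᵖ (∀ i, N i))
  | summand r _ ih => exact r.moduleInjective

/-- Modules in `Prod(E)` are cogenerated by `E`. -/
theorem exists_apply_ne_zero_of_prodOf {M : ModuleCat.{u} Rᵐᵒᵖ} (hM : prodOf E M) {x : M}
    (hx : x ≠ 0) : ∃ f : M →ₗ[Rᵐᵒᵖ] E, f x ≠ 0 := by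
  have key : ∀ {M N : ModuleCat.{u} Rᵐᵒᵖ} (r : Retract M N) {x : M}, x ≠ 0 → r.i.hom x ≠ 0 := by
    intro M N r x hx h
    refine hx ?_
    have := congr($(r.retract).hom x)
    rw [ModuleCat.hom_comp, LinearMap.comp_apply, h, map_zero] at this
    exact this.symm
  induction hM with
  | of M h => exact ⟨h.some.hom.hom, key (Retract.ofIso h.some) hx⟩
  | pi N _ ih =>
    obtain ⟨i, hi⟩ := Function.ne_iff.1 hx
    obtain ⟨f, hf⟩ := ih i hi
    exact ⟨f.comp (LinearMap.proj i), hf⟩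
  | summand r _ ih =>
    obtain ⟨f, hf⟩ := ih (key r hx)
    exact ⟨f.comp r.i.hom, hf⟩

theorem isPureInjective_of_injective {M : ModuleCat.{u} Rᵐᵒᵖ} [Module.Injective Rᵐᵒᵖ M] :
    isPureInjective R M := by
  intro A B f hf g
  obtain ⟨h, hh⟩ := Module.Injective.out f.hom hf.1 g.hom
  exact ⟨ModuleCat.ofHom h, by ext x; exact hh x⟩

theorem isPureEmbedding_id (M : ModuleCat.{u} Rᵐᵒᵖ) : IsPureEmbedding (𝟙 M) := by
  refine ⟨Function.injective_id, fun A _ => ?_⟩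
  have : BalancedTensor.map (R := R) (𝟙 M : M ⟶ M).hom (LinearMap.id : A →ₗ[R] A) =
      AddMonoidHom.id _ := BalancedTensor.hom_ext fun n a => rfl
  rw [this]
  exact Function.injective_id

/-- An injective module is its own pure-injective hull. -/
theorem IsPureInjectiveHull.nonempty_iso_of_injective {M H : ModuleCat.{u} Rᵐᵒᵖ} {f : M ⟶ H}
    (hf : IsPureInjectiveHull f) [Module.Injective Rᵐᵒᵖ M] : Nonempty (H ≅ M) := by
  obtain ⟨g, hg⟩ := isPureInjective_of_injective f hf.pure (𝟙 M)
  have hinj : Function.Injective g.hom := hf.essential g (hg ▸ isPureEmbedding_id M)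
  have hgf : ∀ x, g.hom (f.hom x) = x := fun x => congr($(hg).hom x)
  exact ⟨⟨g, f, by ext x; exact hinj (hgf _), hg⟩⟩

theorem subsingleton_dualModule_iff {M : ModuleCat.{u} R} :
    Subsingleton (dualModule M) ↔ Subsingleton M := by
  constructor
  · intro h
    refine subsingleton_of_forall_eq 0 fun m =>
      CharacterModule.eq_zero_of_character_apply fun c => ?_
    have : c = 0 := h.elim c 0
    rw [this]
    rfl
  · intro h
    exact subsingleton_of_forall_eq (0 : CharacterModule M) fun c : CharacterModule M =>
      CharacterModule.ext _ fun m => by rw [Subsingleton.elim m 0, map_zero, map_zero]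

end Closures

/-! ### Tensor products with an injective module -/

section Contraction

variable {R : Type u} [Ring R]
variable {N : Type u} [AddCommGroup N] [Module Rᵐᵒᵖ N] {A B : Type u} [AddCommGroup A] [Module R A]
  [AddCommGroup B] [Module R B]

namespace BalancedTensor

/-- The biadditive map `(n, a) ↦ n ⊗ a` into `N ⊗_R A`. -/
def tmul : N →+ A →+ BalancedTensor R N A :=
  AddMonoidHom.mk' (fun n => AddMonoidHom.mk' (fun a => QuotientAddGroup.mk (n ⊗ₜ[ℤ] a))
      fun a b => congrArg QuotientAddGroup.mk (TensorProduct.tmul_add n a b))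
    fun n m => AddMonoidHom.ext fun a => congrArg QuotientAddGroup.mk (TensorProduct.add_tmul n m a)

theorem mk_tmul (n : N) (a : A) :
    (QuotientAddGroup.mk (n ⊗ₜ[ℤ] a) : BalancedTensor R N A) = tmul n a := rfl

theorem smul_tmul (n : N) (r : R) (a : A) :
    (tmul (MulOpposite.op r • n) a : BalancedTensor R N A) = tmul n (r • a) := by
  rw [← sub_eq_zero, ← mk_tmul, ← mk_tmul, ← QuotientAddGroup.mk_sub, QuotientAddGroup.eq_zero_iff]
  exact AddSubgroup.subset_closure ⟨n, r, a, rfl⟩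

/-- The contraction `N ⊗_R A → N`, `n ⊗ a ↦ n g(a)`, with a linear form `g` on `A`. -/
def contract (g : A →ₗ[R] R) : BalancedTensor R N A →+ N :=
  QuotientAddGroup.lift _
    (TensorProduct.lift (LinearMap.mk₂ ℤ (fun (n : N) (a : A) => MulOpposite.op (g a) • n)
      (fun n m a => smul_add _ _ _) (fun k n a => smul_comm _ _ _)
      (fun n a b => by rw [map_add, MulOpposite.op_add, add_smul])
      (fun k n a => by rw [map_zsmul, MulOpposite.op_smul, smul_assoc]))).toAddMonoidHom (by
    rw [balancedRelations, AddSubgroup.closure_le]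
    rintro _ ⟨n, r, a, rfl⟩
    simp [mul_smul])

theorem contract_tmul (g : A →ₗ[R] R) (n : N) (a : A) :
    contract g (tmul n a : BalancedTensor R N A) = MulOpposite.op (g a) • n := rfl

theorem contract_map (g : B →ₗ[R] R) (f : A →ₗ[R] B) (x : BalancedTensor R N A) :
    contract g (map (LinearMap.id : N →ₗ[Rᵐᵒᵖ] N) f x) = contract (g.comp f) x := by
  have : (contract g).comp (map (LinearMap.id : N →ₗ[Rᵐᵒᵖ] N) f) = contract (g.comp f) :=
    hom_ext fun n a => rfl
  exact DFunLike.congr_fun this x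

/-- If the `p i` generate `A`, every element of `N ⊗_R A` has the form `∑ nᵢ ⊗ p i`. -/
theorem exists_eq_sum_tmul {n : ℕ} (p : (Fin n → R) →ₗ[R] A) (hp : Function.Surjective p)
    (x : BalancedTensor R N A) :
    ∃ c : Fin n → N, x = ∑ i, tmul (c i) (p (Pi.single i 1)) := by
  obtain ⟨x, rfl⟩ := QuotientAddGroup.mk_surjective x
  induction x using TensorProduct.induction_on with
  | zero => exact ⟨0, by simp⟩
  | tmul m a =>
    obtain ⟨v, rfl⟩ := hp a
    refine ⟨fun i => MulOpposite.op (v i) • m, ?_⟩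
    conv_lhs => rw [pi_eq_sum_univ' v]
    rw [mk_tmul, map_sum, map_sum]
    exact Finset.sum_congr rfl fun i _ => by rw [smul_tmul, map_smul]
  | add x y hx hy =>
    obtain ⟨c, hc⟩ := hx
    obtain ⟨d, hd⟩ := hy
    refine ⟨c + d, ?_⟩
    rw [QuotientAddGroup.mk_add, hc, hd, ← Finset.sum_add_distrib]
    simp

end BalancedTensor

/-- Maps into an injective module factor through any map with a smaller kernel. -/
theorem Module.Injective.exists_comp_eq {S : Type*} [Ring S] {X Y Q : Type v} [AddCommGroup X]
    [Module S X] [AddCommGroup Y] [Module S Y] [AddCommGroup Q] [Module S Q] [Module.Injective S Q]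
    (δ : X →ₗ[S] Y) (ψ : X →ₗ[S] Q) (h : ∀ x, δ x = 0 → ψ x = 0) :
    ∃ χ : Y →ₗ[S] Q, ∀ x, χ (δ x) = ψ x := by
  obtain ⟨χ, hχ⟩ := Module.Injective.out ((LinearMap.ker δ).liftQ δ le_rfl)
    (LinearMap.ker_eq_bot.1 (Submodule.ker_liftQ_eq_bot _ _ _ le_rfl))
    ((LinearMap.ker δ).liftQ ψ h)
  exact ⟨χ, fun x => hχ (Submodule.Quotient.mk x)⟩

namespace BalancedTensor

variable [Module.Injective Rᵐᵒᵖ N]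

/-- For `N` injective and `A` finitely generated, the canonical map
`N ⊗_R A → Hom(Hom(A, R), N)` is surjective. -/
theorem exists_contract_eq [Module.Finite R A] (ψ : (A →ₗ[R] R) →ₗ[Rᵐᵒᵖ] N) :
    ∃ x : BalancedTensor R N A, ∀ g, contract g x = ψ g := by
  obtain ⟨n, p, hp⟩ := Module.Finite.exists_fin' R A
  -- `Hom(A, R)` embeds in `Hom(Rⁿ, R) = Rⁿ`.
  let ev : (A →ₗ[R] R) →ₗ[Rᵐᵒᵖ] (Fin n → R) :=
    { toFun := fun g i => g (p (Pi.single i 1))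
      map_add' := fun _ _ => rfl
      map_smul' := fun _ _ => rfl }
  obtain ⟨χ, hχ⟩ := Module.Injective.exists_comp_eq ev ψ fun g hg => by
    have : g.comp p = 0 := LinearMap.pi_ext' fun i => LinearMap.ext_ring (congrFun hg i)
    have : g = 0 := by
      ext a
      obtain ⟨v, rfl⟩ := hp a
      exact congr($this v)
    rw [this, map_zero]
  refine ⟨∑ i, tmul (χ (Pi.single i 1)) (p (Pi.single i 1)), fun g => ?_⟩
  rw [← hχ, map_sum]
  conv_rhs => rw [← Finset.univ_sum_single (ev g), map_sum]
  refine Finset.sum_congr rfl fun i _ => ?_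
  rw [contract_tmul, ← map_smul]
  congr 1
  ext k
  by_cases h : k = i
  · subst h; simp [ev]
  · simp [h]

/-- For `N` injective and `A` finitely presented, the canonical map
`N ⊗_R A → Hom(Hom(A, R), N)` is injective. -/
theorem eq_zero_of_contract [Module.FinitePresentation R A] {x : BalancedTensor R N A}
    (hx : ∀ g, contract g x = 0) : x = 0 := by
  classical
  obtain ⟨n, K, e, S, hS⟩ := Module.FinitePresentation.exists_fin R A
  let p : (Fin n → R) →ₗ[R] A := e.symm.toLinearMap.comp K.mkQ
  have hp : Function.Surjective p := e.symm.surjective.comp K.mkQ_surjective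
  obtain ⟨c, rfl⟩ := exists_eq_sum_tmul p hp x
  -- the dual `Rⁿ → Rˢ` of the presentation of `A`
  let δ : (Fin n → R) →ₗ[Rᵐᵒᵖ] (S → R) :=
    { toFun := fun v k => ∑ i, k.1 i * v i
      map_add' := fun v w => by ext k; simp [mul_add, Finset.sum_add_distrib]
      map_smul' := fun r v => by ext k; simp [Finset.sum_mul, mul_assoc] }
  let ψ : (Fin n → R) →ₗ[Rᵐᵒᵖ] N :=
    { toFun := fun v => ∑ i, MulOpposite.op (v i) • c i
      map_add' := fun v w => by simp [add_smul, Finset.sum_add_distrib]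
      map_smul' := fun r v => by simp [Finset.smul_sum, mul_smul] }
  obtain ⟨χ, hχ⟩ := Module.Injective.exists_comp_eq δ ψ fun v hv => by
    -- `v` defines a linear form on `Rⁿ` which vanishes on `K`, hence a linear form on `A`.
    let l : (Fin n → R) →ₗ[R] R := ∑ i, (LinearMap.toSpanSingleton R R (v i)).comp (LinearMap.proj i)
    have hl : ∀ w, l w = ∑ i, w i * v i := fun w => by simp [l]
    have hK : K ≤ LinearMap.ker l := by
      rw [← hS, Submodule.span_le]
      intro k hk
      exact (hl k).trans (congrFun hv ⟨k, hk⟩)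
    have := hx ((K.liftQ l hK).comp e.toLinearMap)
    rw [map_sum] at this
    rw [← this]
    change ∑ i, MulOpposite.op (v i) • c i = _
    refine Finset.sum_congr rfl fun i _ => ?_
    have h1 : ((K.liftQ l hK).comp e.toLinearMap) (p (Pi.single i 1)) = v i := by
      simp [p, hl, Pi.single_apply]
    rw [contract_tmul, h1]
  have hc : ∀ i, c i = ∑ k : S, MulOpposite.op (k.1 i) • χ (Pi.single k 1) := by
    intro i
    have h1 : ψ (Pi.single i 1) = c i := by
      simp [ψ, Pi.single_apply, apply_ite MulOpposite.op, ite_smul]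
    have h2 : δ (Pi.single i 1) = ∑ k : S, MulOpposite.op (k.1 i) • Pi.single k 1 := by
      ext k
      simp [δ, Pi.single_apply]
    rw [← h1, ← hχ, h2, map_sum]
    exact Finset.sum_congr rfl fun k _ => map_smul _ _ _
  have hk : ∀ k : S, ∑ i, k.1 i • p (Pi.single i 1) = 0 := by
    intro k
    have : p k.1 = 0 := by
      have : k.1 ∈ K := hS ▸ Submodule.subset_span k.2
      simpa [p] using this
    rw [← this]
    conv_rhs => rw [← Finset.univ_sum_single k.1, map_sum]
    refine Finset.sum_congr rfl fun i _ => ?_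
    rw [← map_smul, ← Pi.single_smul, smul_eq_mul, mul_one]
  calc ∑ i, tmul (c i) (p (Pi.single i 1))
      = ∑ i, ∑ k : S, tmul (χ (Pi.single k 1)) (k.1 i • p (Pi.single i 1)) := by
        refine Finset.sum_congr rfl fun i _ => ?_
        rw [hc i, map_sum, AddMonoidHom.finsetSum_apply]
        exact Finset.sum_congr rfl fun k _ => smul_tmul _ _ _
    _ = ∑ k : S, tmul (χ (Pi.single k 1)) (∑ i, k.1 i • p (Pi.single i 1)) := by
        rw [Finset.sum_comm]
        exact Finset.sum_congr rfl fun k _ => (map_sum _ _ _).symm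
    _ = 0 := Finset.sum_eq_zero fun k _ => by rw [hk, map_zero]

end BalancedTensor

end Contraction

/-! ### Functors on finitely presented modules -/

section Functors

variable {R : Type u} [Ring R]

variable (R) in
/-- The regular left module as an object of the category of finitely presented modules. -/
def regularFP : (isFP R).FullSubcategory :=
  ⟨ModuleCat.of R R, inferInstanceAs (Module.FinitePresentation R R)⟩

namespace FPFunctorCat

/-- The additive map `F(f) : F(A) → F(B)` induced by a homomorphism `f : A → B`. -/
def mapLin (F : FPFunctorCat R) {A B : (isFP R).FullSubcategory} (f : A.obj →ₗ[R] B.obj) :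
    F.obj.obj A →+ F.obj.obj B :=
  (F.obj.map (ObjectProperty.homMk (ModuleCat.ofHom f))).hom

variable (F : FPFunctorCat R) {A B C : (isFP R).FullSubcategory}

theorem mapLin_id (x : F.obj.obj A) : F.mapLin (LinearMap.id : A.obj →ₗ[R] A.obj) x = x :=
  congr($(F.obj.map_id A).hom x)

theorem mapLin_comp (g : B.obj →ₗ[R] C.obj) (f : A.obj →ₗ[R] B.obj) (x : F.obj.obj A) :
    F.mapLin (g.comp f) x = F.mapLin g (F.mapLin f x) :=
  congr($(F.obj.map_comp (ObjectProperty.homMk (ModuleCat.ofHom f))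
    (ObjectProperty.homMk (ModuleCat.ofHom g))).hom x)

theorem mapLin_add (f g : A.obj →ₗ[R] B.obj) (x : F.obj.obj A) :
    F.mapLin (f + g) x = F.mapLin f x + F.mapLin g x :=
  congr($(F.obj.map_add (f := ObjectProperty.homMk (ModuleCat.ofHom f))
    (g := ObjectProperty.homMk (ModuleCat.ofHom g))).hom x)

theorem mapLin_zero (x : F.obj.obj A) : F.mapLin (0 : A.obj →ₗ[R] B.obj) x = 0 := by
  have := F.mapLin_add (0 : A.obj →ₗ[R] B.obj) 0 x
  simpa using this

theorem naturality_apply {F G : FPFunctorCat R} (t : F ⟶ G) (f : A.obj →ₗ[R] B.obj)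
    (x : F.obj.obj A) : (t.hom.app B).hom (F.mapLin f x) = G.mapLin f ((t.hom.app A).hom x) :=
  congr($(t.hom.naturality (ObjectProperty.homMk (ModuleCat.ofHom f))).hom x)

theorem hom_ext {F G : FPFunctorCat R} {s t : F ⟶ G}
    (h : ∀ A (x : F.obj.obj A), (s.hom.app A).hom x = (t.hom.app A).hom x) : s = t := by
  apply ObjectProperty.hom_ext
  ext A x
  exact h A x

/-- Morphisms of functors from pointwise additive maps which are natural. -/
def mkHom {F G : FPFunctorCat R} (t : ∀ A, F.obj.obj A →+ G.obj.obj A)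
    (ht : ∀ (A B : (isFP R).FullSubcategory) (f : A.obj →ₗ[R] B.obj) x,
      t B (F.mapLin f x) = G.mapLin f (t A x)) : F ⟶ G :=
  ObjectProperty.homMk
    { app := fun A => AddCommGrpCat.ofHom (t A)
      naturality := fun A B f => by ext x; exact ht A B f.hom.hom x }

variable (A) in
/-- The functor `Hom(A, -)`. -/
def represented : FPFunctorCat R :=
  AdditiveFunctor.of (preadditiveCoyoneda.obj (Opposite.op A))

/-- Monomorphisms of functors are injective at every object: an element of the kernel at `A`
is a morphism out of the functor `Hom(A, -)`. -/
theorem app_injective {F G : FPFunctorCat R} (t : F ⟶ G) [Mono t] (A : (isFP R).FullSubcategory) :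
    Function.Injective (t.hom.app A).hom := by
  rw [injective_iff_map_eq_zero]
  intro x hx
  let s : represented A ⟶ F := mkHom
    (fun B => AddMonoidHom.mk' (fun f : A ⟶ B => F.mapLin f.hom.hom x)
      fun f g => F.mapLin_add _ _ x)
    fun B C f (g : A ⟶ B) => F.mapLin_comp f g.hom.hom x
  have hs : s = 0 := by
    rw [← cancel_mono t]
    refine hom_ext fun B (f : A ⟶ B) => ?_
    change (t.hom.app B).hom (F.mapLin f.hom.hom x) = (t.hom.app B).hom 0
    rw [naturality_apply, hx, map_zero, map_zero]
  have := congr(($(hs).hom.app A).hom (𝟙 A))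
  exact (F.mapLin_id x).symm.trans this

theorem mono_of_injective {F G : FPFunctorCat R} (t : F ⟶ G)
    (ht : ∀ A, Function.Injective (t.hom.app A).hom) : Mono t :=
  ⟨fun _ _ h => hom_ext fun A x => ht A congr(($(h).hom.app A).hom x)⟩

/-- The group `F(R)`. -/
def atRing : Type u := F.obj.obj (regularFP R)

instance : AddCommGroup F.atRing := inferInstanceAs (AddCommGroup (F.obj.obj (regularFP R)))

/-- Right multiplication by `r` as an endomorphism of the regular left module. -/
def mulRight (r : R) : (regularFP R).obj →ₗ[R] (regularFP R).obj := LinearMap.toSpanSingleton R R r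

/-- `F(R)` is a right module, `r` acting through right multiplication by `r` on `R`. -/
instance : Module Rᵐᵒᵖ F.atRing where
  smul r x := F.mapLin (mulRight r.unop) x
  one_smul x := by
    refine Eq.trans ?_ (F.mapLin_id x)
    exact congrArg (fun l => F.mapLin l x) (LinearMap.ext fun a : R => mul_one a)
  mul_smul r s x := by
    refine Eq.trans ?_ (F.mapLin_comp _ _ x)
    exact congrArg (fun l => F.mapLin l x) (LinearMap.ext fun a : R => (mul_assoc a s.unop r.unop).symm)
  smul_zero r := map_zero _
  smul_add r x y := map_add _ x y
  add_smul r s x := by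
    refine Eq.trans ?_ (F.mapLin_add _ _ x)
    exact congrArg (fun l => F.mapLin l x) (LinearMap.ext fun a : R => mul_add a r.unop s.unop)
  zero_smul x := by
    refine Eq.trans ?_ (F.mapLin_zero x)
    exact congrArg (fun l => F.mapLin l x) (LinearMap.ext fun a : R => mul_zero a)

/-- The evaluation `x ↦ F(g)(x)` of `x ∈ F(A)` at the linear forms `g` on `A`. -/
def evalForm (g : A.obj →ₗ[R] R) : F.obj.obj A →+ F.atRing := F.mapLin (B := regularFP R) g

/-- `g ↦ F(g)(x)` as a homomorphism of right modules. -/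
def evalFormHom (x : F.obj.obj A) : (A.obj →ₗ[R] R) →ₗ[Rᵐᵒᵖ] F.atRing where
  toFun g := F.evalForm g x
  map_add' g h := F.mapLin_add (B := regularFP R) g h x
  map_smul' r g := F.mapLin_comp (B := regularFP R) (C := regularFP R) (mulRight r.unop) g x

theorem evalForm_mapLin (g : B.obj →ₗ[R] R) (f : A.obj →ₗ[R] B.obj) (x : F.obj.obj A) :
    F.evalForm g (F.mapLin f x) = F.evalForm (g.comp f) x :=
  (F.mapLin_comp (C := regularFP R) g f x).symm

/-- The map `F(R) → G(R)` induced by a morphism of functors. -/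
def atRingMap {F G : FPFunctorCat R} (t : F ⟶ G) : F.atRing →ₗ[Rᵐᵒᵖ] G.atRing where
  toFun x := (t.hom.app (regularFP R)).hom x
  map_add' x y := map_add (t.hom.app (regularFP R)).hom x y
  map_smul' r x := naturality_apply t (mulRight r.unop) x

theorem atRingMap_evalForm {F G : FPFunctorCat R} (t : F ⟶ G) (g : A.obj →ₗ[R] R)
    (x : F.obj.obj A) :
    atRingMap t (F.evalForm g x) = G.evalForm g ((t.hom.app A).hom x) :=
  naturality_apply (B := regularFP R) t g x

/-- The identification of `N ⊗_R R` with `N`. -/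
def tensorAtRing (N : ModuleCat.{u} Rᵐᵒᵖ) : (tensorFunctor N).atRing →ₗ[Rᵐᵒᵖ] N where
  toFun x := BalancedTensor.contract (A := R) LinearMap.id x
  map_add' x y := map_add (BalancedTensor.contract (A := R) LinearMap.id) x y
  map_smul' r x := by
    have : (BalancedTensor.contract (A := R) (LinearMap.id : R →ₗ[R] R)).comp
        (BalancedTensor.map (LinearMap.id : N →ₗ[Rᵐᵒᵖ] N) (LinearMap.toSpanSingleton R R r.unop)) =
      (DistribSMul.toAddMonoidHom N r).comp (BalancedTensor.contract (A := R) LinearMap.id) :=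
      BalancedTensor.hom_ext fun n a => mul_smul r (MulOpposite.op a) n
    exact DFunLike.congr_fun this x

theorem tensorAtRing_evalForm {N : ModuleCat.{u} Rᵐᵒᵖ} (g : A.obj →ₗ[R] R)
    (x : (tensorFunctor N).obj.obj A) :
    tensorAtRing N ((tensorFunctor N).evalForm g x) = BalancedTensor.contract g x :=
  BalancedTensor.contract_map (B := R) LinearMap.id g x

/-- The homomorphism `F(R) → N` defined by a morphism `F → N ⊗_R -`. -/
def toAtRing {N : ModuleCat.{u} Rᵐᵒᵖ} (t : F ⟶ tensorFunctor N) : F.atRing →ₗ[Rᵐᵒᵖ] N :=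
  (tensorAtRing N).comp (atRingMap t)

theorem contract_app {F : FPFunctorCat R} {N : ModuleCat.{u} Rᵐᵒᵖ} (t : F ⟶ tensorFunctor N)
    (g : A.obj →ₗ[R] R) (x : F.obj.obj A) :
    BalancedTensor.contract (N := N) (A := A.obj) g ((t.hom.app A).hom x) =
      F.toAtRing t (F.evalForm g x) := by
  rw [toAtRing, LinearMap.comp_apply, atRingMap_evalForm, tensorAtRing_evalForm]

instance (A : (isFP R).FullSubcategory) : Module.FinitePresentation R A.obj := A.property

/-- Since `N ⊗_R A = Hom(Hom(A, R), N)` for `N` injective, every homomorphism `F(R) → N`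
comes from a morphism `F → N ⊗_R -`. -/
theorem exists_toAtRing_eq {F : FPFunctorCat R} {N : ModuleCat.{u} Rᵐᵒᵖ} [Module.Injective Rᵐᵒᵖ N]
    (φ : F.atRing →ₗ[Rᵐᵒᵖ] N) :
    ∃ t : F ⟶ tensorFunctor N, ∀ A (g : A.obj →ₗ[R] R) (x : F.obj.obj A),
      BalancedTensor.contract (N := N) (A := A.obj) g ((t.hom.app A).hom x) = φ (F.evalForm g x) := by
  choose t ht using fun (A : (isFP R).FullSubcategory) (x : F.obj.obj A) =>
    BalancedTensor.exists_contract_eq (N := N) (φ.comp (F.evalFormHom x))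
  have hext : ∀ (A : (isFP R).FullSubcategory) (x y : BalancedTensor R N A.obj),
      (∀ g, BalancedTensor.contract g x = BalancedTensor.contract g y) → x = y := by
    intro A x y h
    rw [← sub_eq_zero]
    exact BalancedTensor.eq_zero_of_contract fun g => by rw [map_sub, h, sub_self]
  have ht' : ∀ A x g, BalancedTensor.contract g (t A x) = φ (F.evalForm g x) := ht
  refine ⟨mkHom (fun A => AddMonoidHom.mk' (t A) fun x y =>
      hext A _ (t A x + t A y : BalancedTensor R N A.obj) fun g => ?_)
    fun A B f x => hext B _ _ fun g => ?_, fun A g x => ht A x g⟩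
  · rw [map_add (BalancedTensor.contract g), ht', ht', ht', map_add, map_add]
  · refine Eq.trans ?_ (BalancedTensor.contract_map g f (t A x)).symm
    rw [ht' A, ← evalForm_mapLin]
    exact ht' B _ g

end FPFunctorCat

end Functors

/-! ### The torsion theory cogenerated by an injective module -/

section TorsionTheory

variable {R : Type u} [Ring R]

namespace FPFunctorCat

/-- For `N` injective, `N ⊗_R -` is an injective object: a morphism `F → N ⊗_R -` is the same
as a homomorphism `F(R) → N`, and `F ↦ F(R)` preserves monomorphisms. -/
instance tensorFunctor_injective (N : ModuleCat.{u} Rᵐᵒᵖ) [Module.Injective Rᵐᵒᵖ N] :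
    Injective (tensorFunctor N) where
  factors {X Y} s i _ := by
    obtain ⟨φ, hφ⟩ := Module.Injective.out (atRingMap i) (app_injective i (regularFP R))
      (X.toAtRing s)
    obtain ⟨t, ht⟩ := exists_toAtRing_eq φ
    refine ⟨t, hom_ext fun A x => ?_⟩
    change (t.hom.app A).hom ((i.hom.app A).hom x) = _
    refine sub_eq_zero.1 (BalancedTensor.eq_zero_of_contract (N := N) (A := A.obj) fun g => ?_)
    refine (map_sub (BalancedTensor.contract (N := N) (A := A.obj) g) _ _).trans ?_
    rw [ht, contract_app, ← atRingMap_evalForm, hφ, sub_self]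

/-- The functors `N ⊗_R -` with `N` in `Prod(E)` cogenerate the same class as `E ⊗_R -`. As the
finitely presented modules are essentially small, one product of copies of `E` suffices
to embed a functor whose elements are separated by homomorphisms `G(R) → E`. -/
theorem cogeneratedClass_prodOf_iff {E : ModuleCat.{u} Rᵐᵒᵖ} [Module.Injective Rᵐᵒᵖ E]
    {G : FPFunctorCat R} : cogeneratedClass (prodOf E) G ↔
      ∀ (A : (isFP R).FullSubcategory) (x : G.obj.obj A), x ≠ 0 →
        ∃ (φ : G.atRing →ₗ[Rᵐᵒᵖ] E) (g : A.obj →ₗ[R] R), φ (G.evalForm g x) ≠ 0 := by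
  constructor
  · rintro ⟨N, hN, i, hi⟩ A x hx
    have := prodOf_injective hN
    by_contra! h
    refine hx ((injective_iff_map_eq_zero _).1 (app_injective i A) x ?_)
    refine BalancedTensor.eq_zero_of_contract (N := N) (A := A.obj) fun g => ?_
    rw [contract_app]
    by_contra hne
    obtain ⟨f, hf⟩ := exists_apply_ne_zero_of_prodOf hN hne
    exact hf (h (f.comp (G.toAtRing i)) g)
  · intro h
    -- representatives of the finitely presented modules
    let rep : (Σ n, {K : Submodule R (Fin n → R) // K.FG}) → (isFP R).FullSubcategory := fun k =>
      ⟨ModuleCat.of R ((Fin k.1 → R) ⧸ k.2.1),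
        Module.finitePresentation_of_surjective k.2.1.mkQ k.2.1.mkQ_surjective
          (by rw [Submodule.ker_mkQ]; exact k.2.2)⟩
    choose φ hφ using fun i : Σ k, {x : G.obj.obj (rep k) // x ≠ 0} => h (rep i.1) i.2.1 i.2.2
    obtain ⟨t, ht⟩ := exists_toAtRing_eq (F := G)
      (N := ModuleCat.of Rᵐᵒᵖ ((Σ k, {x : G.obj.obj (rep k) // x ≠ 0}) → E)) (LinearMap.pi φ)
    refine ⟨_, prodOf_pi _, t, mono_of_injective t fun A => ?_⟩
    rw [injective_iff_map_eq_zero]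
    intro x hx
    by_contra hne
    obtain ⟨n, K, e, hK⟩ := Module.FinitePresentation.exists_fin R A.obj
    let k : Σ n, {K : Submodule R (Fin n → R) // K.FG} := ⟨n, K, hK⟩
    let l : A.obj →ₗ[R] (rep k).obj := e.toLinearMap
    have hy : G.mapLin l x ≠ 0 := by
      intro hy
      let l' : (rep k).obj →ₗ[R] A.obj := e.symm.toLinearMap
      have h1 : l'.comp l = LinearMap.id := LinearMap.ext e.symm_apply_apply
      have h2 := G.mapLin_comp l' l x
      rw [h1, mapLin_id, hy, map_zero] at h2
      exact hne h2
    obtain ⟨g, hg⟩ := hφ ⟨k, G.mapLin l x, hy⟩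
    rw [evalForm_mapLin] at hg
    have h3 := ht A (g.comp l) x
    rw [hx] at h3
    have h4 := congrFun ((map_zero (BalancedTensor.contract _)).symm.trans h3)
      ⟨k, G.mapLin l x, hy⟩
    exact hg h4.symm

/-- The subfunctor with given values. -/
def subfunctor (F : FPFunctorCat R) (S : ∀ A, AddSubgroup (F.obj.obj A))
    (hS : ∀ (A B : (isFP R).FullSubcategory) (f : A ⟶ B), ∀ x ∈ S A, (F.obj.map f).hom x ∈ S B) :
    FPFunctorCat R :=
  let F' : (isFP R).FullSubcategory ⥤ AddCommGrpCat.{u} :=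
    { obj := fun A => AddCommGrpCat.of (S A)
      map := fun {A B} f => AddCommGrpCat.ofHom
        (((F.obj.map f).hom.comp (S A).subtype).codRestrict (S B) fun x => hS A B f x x.2)
      map_id := fun A => by
        ext x
        have h := congr($(F.obj.map_id A).hom (x : F.obj.obj _))
        exact h
      map_comp := fun f g => by
        ext x
        have h := congr($(F.obj.map_comp f g).hom (x : F.obj.obj _))
        exact h }
  have : F'.Additive :=
    { map_add := fun {A B f g} => by
        ext x
        have h := congr($(F.obj.map_add (f := f) (g := g)).hom (x : F.obj.obj _))
        exact h }
  AdditiveFunctor.of F'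

/-- The inclusion of a subfunctor. -/
def subfunctorι (F : FPFunctorCat R) (S : ∀ A, AddSubgroup (F.obj.obj A)) (hS) :
    subfunctor F S hS ⟶ F :=
  mkHom (F := subfunctor F S hS) (fun A => (S A).subtype) fun _ _ _ _ => rfl

instance (F : FPFunctorCat R) (S : ∀ A, AddSubgroup (F.obj.obj A)) (hS) :
    Mono (subfunctorι F S hS) :=
  mono_of_injective _ fun A => (S A).subtype_injective

/-- The functors cogenerated by an injective module are the torsionfree class of a hereditary
torsion theory. The torsion part of `Y` consists of the elements which no homomorphism
`Y(R) → E` detects. -/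
theorem isHereditaryTorsionTheory_cogeneratedClass (E : ModuleCat.{u} Rᵐᵒᵖ)
    [Module.Injective Rᵐᵒᵖ E] :
    IsHereditaryTorsionTheory
      (fun X => ∀ Y, cogeneratedClass (prodOf E) Y → ∀ f : X ⟶ Y, f = 0)
      (cogeneratedClass (prodOf E)) where
  torsion_iff X := Iff.rfl
  torsionfree_iff Y := by
    refine ⟨fun hY X hX f => hX Y hY f, fun h => cogeneratedClass_prodOf_iff.2 ?_⟩
    let S : ∀ A, AddSubgroup (Y.obj.obj A) := fun A =>
      { carrier := {x | ∀ (φ : Y.atRing →ₗ[Rᵐᵒᵖ] E) (g : A.obj →ₗ[R] R), φ (Y.evalForm g x) = 0}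
        zero_mem' := fun φ g => by rw [map_zero, map_zero]
        add_mem' := fun hx hy φ g => by rw [map_add, map_add, hx, hy, add_zero]
        neg_mem' := fun hx φ g => by rw [map_neg, map_neg, hx, neg_zero] }
    have hS : ∀ (A B : (isFP R).FullSubcategory) (f : A ⟶ B), ∀ x ∈ S A,
        (Y.obj.map f).hom x ∈ S B := fun A B f x hx φ g => by
      change φ (Y.evalForm g (Y.mapLin f.hom.hom x)) = 0
      rw [evalForm_mapLin]
      exact hx _ _
    have hzero : subfunctorι Y S hS = 0 := by
      refine h _ ?_ _
      rintro Z ⟨N, hN, i, hi⟩ s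
      have := prodOf_injective hN
      rw [← cancel_mono i, Limits.zero_comp]
      let t := Injective.factorThru (s ≫ i) (subfunctorι Y S hS)
      rw [← Injective.comp_factorThru (s ≫ i) (subfunctorι Y S hS)]
      refine hom_ext fun A x => ?_
      refine BalancedTensor.eq_zero_of_contract (N := N) (A := A.obj) fun g => ?_
      refine (contract_app t g x.1).trans ?_
      by_contra hne
      obtain ⟨f, hf⟩ := exists_apply_ne_zero_of_prodOf hN hne
      exact hf (x.2 (f.comp (Y.toAtRing t)) g)
    intro A x hx
    by_contra! hx'
    exact hx congr(($(hzero).hom.app A).hom ⟨x, hx'⟩)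
  hereditary X Y i hi hY := by
    rintro Z ⟨N, hN, k, hk⟩ s
    have := prodOf_injective hN
    rw [← cancel_mono k, Limits.zero_comp, ← Injective.comp_factorThru (s ≫ k) i,
      hY _ ⟨N, hN, 𝟙 _, inferInstance⟩ (Injective.factorThru (s ≫ k) i), Limits.comp_zero]

/-- A subobject `N ⊗_R -` of `N' ⊗_R -` comes from a pure embedding of `N` into `N'`. -/
theorem exists_isPureEmbedding {N N' : ModuleCat.{u} Rᵐᵒᵖ} (t : tensorFunctor N ⟶ tensorFunctor N')
    [Mono t] : ∃ f : N ⟶ N', IsPureEmbedding f := by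
  let u : N →ₗ[Rᵐᵒᵖ] (tensorFunctor N).atRing :=
    { toFun := fun n => BalancedTensor.tmul (A := R) n (1 : R)
      map_add' := fun n m => by rw [map_add]; rfl
      map_smul' := fun r n => by
        refine (BalancedTensor.smul_tmul (A := R) n r.unop (1 : R)).trans ?_
        change BalancedTensor.tmul (A := R) n (r.unop * 1) =
          BalancedTensor.tmul (A := R) n (1 * r.unop)
        rw [one_mul, mul_one] }
  have hu : ∀ n, tensorAtRing N (u n) = n := fun n => one_smul _ n
  have hN' : ∀ z : BalancedTensor R N' R,
      BalancedTensor.tmul (BalancedTensor.contract (A := R) LinearMap.id z) (1 : R) = z := by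
    have : (BalancedTensor.tmul.flip (1 : R)).comp
        (BalancedTensor.contract (N := N') (A := R) LinearMap.id) = AddMonoidHom.id _ :=
      BalancedTensor.hom_ext fun n (a : R) => by
        refine (BalancedTensor.smul_tmul n a (1 : R)).trans ?_
        rw [smul_eq_mul, mul_one]
        rfl
    exact DFunLike.congr_fun this
  let f : N →ₗ[Rᵐᵒᵖ] N' := ((tensorFunctor N).toAtRing t).comp u
  have hf : ∀ n, (atRingMap t (u n) : BalancedTensor R N' R) =
      BalancedTensor.tmul (f n) (1 : R) := fun n => (hN' _).symm
  have key : ∀ A : (isFP R).FullSubcategory,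
      (t.hom.app A).hom = BalancedTensor.map f (LinearMap.id : A.obj →ₗ[R] A.obj) := by
    intro A
    refine BalancedTensor.hom_ext fun n a => ?_
    have h1 := naturality_apply (A := regularFP R) (B := A) t (LinearMap.toSpanSingleton R A.obj a)
      (u n)
    have h2 : (tensorFunctor N).mapLin (A := regularFP R) (B := A)
        (LinearMap.toSpanSingleton R A.obj a) (u n) = BalancedTensor.tmul (A := A.obj) n a :=
      congrArg (BalancedTensor.tmul (A := A.obj) n) (one_smul R a)
    rw [h2] at h1
    refine h1.trans ?_
    refine (congrArg ((tensorFunctor N').mapLin (A := regularFP R) (B := A)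
      (LinearMap.toSpanSingleton R A.obj a)) (hf n)).trans ?_
    exact congrArg (BalancedTensor.tmul (A := A.obj) (f n)) (one_smul R a)
  refine ⟨ModuleCat.ofHom f, ?_, fun A hA => ?_⟩
  · rw [ModuleCat.hom_ofHom, ← LinearMap.ker_eq_bot, LinearMap.ker_eq_bot']
    intro n hn
    have h1 : atRingMap t (u n) = 0 := by
      refine (hf n).trans ?_
      rw [hn, map_zero]
      rfl
    have h2 : u n = 0 :=
      (injective_iff_map_eq_zero (t.hom.app (regularFP R)).hom).1 (app_injective t _) (u n) h1
    rw [← hu n, h2, map_zero]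
  · have := app_injective t ⟨A, hA⟩
    rw [key] at this
    exact this

end FPFunctorCat

end TorsionTheory

/-! ### Pairs whose left class vanishes -/

section VanishingDuals

variable {R : Type u} [Ring R]

theorem subsingleton_of_dualClass {S : ObjectProperty (ModuleCat.{u} R)}
    (hS : ∀ M, S M → Subsingleton M) (N : ModuleCat.{u} Rᵐᵒᵖ) (hN : dualClass S N) :
    Subsingleton N := by
  obtain ⟨M, hM, ⟨e⟩⟩ := hN
  have := subsingleton_dualModule_iff.2 (hS M hM)
  exact e.toLinearEquiv.toEquiv.subsingleton

theorem subsingleton_of_zeroClass (M : ModuleCat.{u} R) (h : zeroClass R M) : Subsingleton M :=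
  ModuleCat.isZero_iff_subsingleton.1 h

variable {E : ModuleCat.{u} Rᵐᵒᵖ}

theorem isAlmostDualPair_zeroClass [Module.Injective Rᵐᵒᵖ E]
    (h : ∀ M : ModuleCat.{u} R, prodOf E (dualModule M) → Subsingleton M) :
    IsAlmostDualPair (zeroClass R) (prodOf E) where
  prod_eq := (prodClosure_idem _).symm
  hull M H f hM hf := by
    have := prodOf_injective hM
    exact .summand (Retract.ofIso hf.nonempty_iso_of_injective.some) hM
  mem_iff M := by
    rw [zeroClass, ModuleCat.isZero_iff_subsingleton]
    refine ⟨fun hM => ?_, h M⟩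
    have := subsingleton_dualModule_iff.2 hM
    exact prodOf_of_subsingleton

/-- If no nonzero module has its dual in `Prod(E)`, then `Prod(E)` is not of the form
`Prod(𝒮*)`, as the latter would consist of zero modules. -/
theorem prodOf_ne_prodClosure_dualClass [Nontrivial E]
    (h : ∀ M : ModuleCat.{u} R, prodOf E (dualModule M) → Subsingleton M)
    (S : ObjectProperty (ModuleCat.{u} R)) : prodOf E ≠ prodClosure (dualClass S) := by
  intro hS
  have hE : prodClosure (dualClass S) E := hS ▸ prodOf_self
  refine not_subsingleton E (subsingleton_of_prodClosure (subsingleton_of_dualClass ?_) hE)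
  exact fun M hM => h M (hS ▸ .of _ ⟨M, hM, ⟨Iso.refl _⟩⟩)

/-- If no nonzero module has its dual in `Prod(E)`, then the torsion theory cogenerated by `E`
does not arise from a dual pair `(𝒮, 𝒫)`. Otherwise `M* ⊗_R -` embeds in some `N ⊗_R -` with
`N ∈ Prod(E)` for all `M ∈ 𝒮`. This embedding comes from a pure embedding `M* → N`, which
splits as `M*` is pure-injective. So `M* ∈ Prod(E)`, and `M = 0`. Thus `Prod(𝒮*)` consists
of zero modules, but `E ⊗_R -` is nonzero. -/
theorem cogeneratedClass_prodOf_ne [Nontrivial E]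
    (h : ∀ M : ModuleCat.{u} R, prodOf E (dualModule M) → Subsingleton M)
    {S : ObjectProperty (ModuleCat.{u} R)} {P : ObjectProperty (ModuleCat.{u} Rᵐᵒᵖ)}
    (hSP : IsDualPair S P) : cogeneratedClass (prodOf E) ≠ cogeneratedClass (pinj P) := by
  intro heq
  have hS : ∀ M, S M → Subsingleton M := by
    intro M hM
    have hM' : pinj P (dualModule M) := hSP.2 ▸ .of _ ⟨M, hM, ⟨Iso.refl _⟩⟩
    have : cogeneratedClass (prodOf E) (tensorFunctor (dualModule M)) :=
      heq ▸ ⟨_, hM', 𝟙 _, inferInstance⟩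
    obtain ⟨N, hN, i, hi⟩ := this
    obtain ⟨f, hf⟩ := FPFunctorCat.exists_isPureEmbedding i
    obtain ⟨r, hr⟩ := hM'.2 f hf (𝟙 _)
    exact h M (.summand ⟨f, r, hr⟩ hN)
  have : cogeneratedClass (pinj P) (tensorFunctor E) :=
    heq ▸ ⟨_, prodOf_self, 𝟙 _, inferInstance⟩
  obtain ⟨N, hN, i, hi⟩ := this
  obtain ⟨f, hf⟩ := FPFunctorCat.exists_isPureEmbedding i
  rw [← hSP.2] at hN
  have := subsingleton_of_prodClosure (subsingleton_of_dualClass hS) hN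
  exact not_subsingleton E hf.1.subsingleton

theorem prodClosure_dualClass_zeroClass_lt [Nontrivial E] [Module.Injective Rᵐᵒᵖ E] :
    prodClosure (dualClass (zeroClass R)) < pinj (prodOf E) := by
  have hsub : ∀ M, prodClosure (dualClass (zeroClass R)) M → Subsingleton M := fun M hM =>
    subsingleton_of_prodClosure (subsingleton_of_dualClass subsingleton_of_zeroClass) hM
  refine lt_of_le_not_ge (fun M hM => ?_) fun hle => ?_
  · have := hsub M hM
    have hM' : prodOf E M := prodOf_of_subsingleton
    have := prodOf_injective hM'
    exact ⟨hM', isPureInjective_of_injective⟩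
  · exact not_subsingleton E (hsub E (hle E ⟨prodOf_self, isPureInjective_of_injective⟩))

end VanishingDuals

/-! ### The free algebra on two generators -/

section RightModuleElements

variable {R : Type*} [Ring R] {N : Type*} [AddCommGroup N] [Module Rᵐᵒᵖ N]

/-- The homomorphism `r ↦ n r` from the regular right module. -/
def elementHom (n : N) : R →ₗ[Rᵐᵒᵖ] N where
  toFun r := MulOpposite.op r • n
  map_add' r s := by rw [MulOpposite.op_add, add_smul]
  map_smul' r s := mul_smul r (MulOpposite.op s) n

theorem elementHom_apply (n : N) (r : R) : elementHom n r = MulOpposite.op r • n := rfl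

theorem map_op_smul_one (f : R →ₗ[Rᵐᵒᵖ] N) (r : R) : MulOpposite.op r • f 1 = f r := by
  rw [← map_smul, op_smul_eq_mul, one_mul]

theorem elementHom_injective [IsDomain R] {a : R} (ha : a ≠ 0) :
    Function.Injective (elementHom a : R →ₗ[Rᵐᵒᵖ] R) := fun _ _ h => mul_left_cancel₀ ha h

/-- An element of a product of injective hulls of a domain has a multiple which generates a
free submodule. -/
theorem exists_injective_hom_of_pi {R E : Type u} [Ring R] [IsDomain R] [AddCommGroup E]
    [Module Rᵐᵒᵖ E] {j : R →ₗ[Rᵐᵒᵖ] E} (hj : IsInjectiveHull j) {κ : Type v}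
    {N : Submodule Rᵐᵒᵖ (κ → E)} (hN : N ≠ ⊥) :
    ∃ f : R →ₗ[Rᵐᵒᵖ] N, Function.Injective f := by
  obtain ⟨x, hx, hx0⟩ := N.ne_bot_iff.1 hN
  obtain ⟨k, hk⟩ := Function.ne_iff.1 hx0
  obtain ⟨a, m, hm, ham⟩ := hj.exists_smul_eq hk
  refine ⟨elementHom (R := R) (a • ⟨x, hx⟩), Function.Injective.of_comp
    (f := ((LinearMap.proj k : (κ → E) →ₗ[Rᵐᵒᵖ] E).comp N.subtype : N → E)) ?_⟩
  have : ((LinearMap.proj k : (κ → E) →ₗ[Rᵐᵒᵖ] E).comp N.subtype) ∘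
      elementHom (R := R) (a • ⟨x, hx⟩) = j ∘ elementHom (R := R) m := by
    ext r
    change MulOpposite.op r • a • x k = j (MulOpposite.op r • m)
    rw [ham, map_smul]
  rw [this]
  exact hj.mono.comp (elementHom_injective (R := R) hm)

end RightModuleElements

namespace FreeAlgebra

variable {K : Type*} [Field K] {X : Type*}

theorem eq_zero_of_ι_mul_eq_ι_mul {i j : X} (hij : i ≠ j) {a b : FreeAlgebra K X}
    (h : ι K i * a = ι K j * b) : a = 0 := by
  refine equivMonoidAlgebraFreeMonoid.injective ?_
  rw [map_zero]
  ext w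
  have h' := congr((equivMonoidAlgebraFreeMonoid $h).coeff (FreeMonoid.of i * w))
  have hι : ∀ k : X, equivMonoidAlgebraFreeMonoid (ι K k) =
      MonoidAlgebra.single (FreeMonoid.of k) 1 := fun k => by
    simp [equivMonoidAlgebraFreeMonoid]
  rw [map_mul equivMonoidAlgebraFreeMonoid, map_mul equivMonoidAlgebraFreeMonoid, hι, hι,
    MonoidAlgebra.coeff_single_mul_of_forall_mul_ne (m := FreeMonoid.of j),
    MonoidAlgebra.coeff_single_mul_eq_mul_coeff w (fun m _ => mul_right_inj _), one_mul] at h'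
  · exact h'
  · intro d hd
    have := congrArg FreeMonoid.toList hd
    simp only [FreeMonoid.toList_of_mul, List.cons.injEq] at this
    exact hij this.1.symm

theorem eq_zero_of_mul_ι_eq_mul_ι {i j : X} (hij : i ≠ j) {a b : FreeAlgebra K X}
    (h : a * ι K i = b * ι K j) : a = 0 := by
  refine equivMonoidAlgebraFreeMonoid.injective ?_
  rw [map_zero]
  ext w
  have h' := congr((equivMonoidAlgebraFreeMonoid $h).coeff (w * FreeMonoid.of i))
  have hι : ∀ k : X, equivMonoidAlgebraFreeMonoid (ι K k) =
      MonoidAlgebra.single (FreeMonoid.of k) 1 := fun k => by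
    simp [equivMonoidAlgebraFreeMonoid]
  rw [map_mul equivMonoidAlgebraFreeMonoid, map_mul equivMonoidAlgebraFreeMonoid, hι, hι,
    MonoidAlgebra.coeff_mul_single_of_forall_mul_ne (m := FreeMonoid.of j),
    MonoidAlgebra.coeff_mul_single_eq_coeff_mul w (fun m _ => mul_left_inj _), mul_one] at h'
  · exact h'
  · intro d hd
    have := congrArg FreeMonoid.toList hd
    simp only [FreeMonoid.toList_mul, FreeMonoid.toList_of] at this
    have := List.append_inj_right' this rfl
    simp only [List.cons.injEq, and_true] at this
    exact hij this.symm

end FreeAlgebra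

section FreeAlgebraTwo

variable {K : Type u} [Field K]

variable (K) in
/-- The free algebra `K⟨X, Y⟩`. -/
abbrev FreeTwo : Type u := FreeAlgebra K (Fin 2)

/-- A left module containing a copy of `R` contains independent copies of `R X` and `R Y`. -/
theorem exists_disjoint_of_injective_left {N : Type*} [AddCommGroup N] [Module (FreeTwo K) N]
    (f : FreeTwo K →ₗ[FreeTwo K] N) (hf : Function.Injective f) :
    ∃ A B : Submodule (FreeTwo K) N, A ≠ ⊥ ∧ B ≠ ⊥ ∧ Disjoint A B := by
  have h0 : ∀ i, f (FreeAlgebra.ι K i) ≠ 0 := fun i h =>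
    FreeAlgebra.ι_ne_zero i (hf (h.trans (map_zero f).symm))
  refine ⟨FreeTwo K ∙ f (FreeAlgebra.ι K 0), FreeTwo K ∙ f (FreeAlgebra.ι K 1), ?_, ?_, ?_⟩
  · simpa using h0 0
  · simpa using h0 1
  · refine Submodule.disjoint_def.2 fun x hx hy => ?_
    obtain ⟨a, rfl⟩ := Submodule.mem_span_singleton.1 hx
    obtain ⟨b, hb⟩ := Submodule.mem_span_singleton.1 hy
    rw [← map_smul, ← map_smul] at hb
    rw [FreeAlgebra.eq_zero_of_mul_ι_eq_mul_ι zero_ne_one (hf hb).symm, zero_smul]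

/-- A right module containing a copy of `R` contains independent copies of `X R` and `Y R`. -/
theorem exists_disjoint_of_injective_right {N : Type*} [AddCommGroup N] [Module (FreeTwo K)ᵐᵒᵖ N]
    (f : FreeTwo K →ₗ[(FreeTwo K)ᵐᵒᵖ] N) (hf : Function.Injective f) :
    ∃ A B : Submodule (FreeTwo K)ᵐᵒᵖ N, A ≠ ⊥ ∧ B ≠ ⊥ ∧ Disjoint A B := by
  have h0 : ∀ i, f (FreeAlgebra.ι K i) ≠ 0 := fun i h =>
    FreeAlgebra.ι_ne_zero i (hf (h.trans (map_zero f).symm))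
  refine ⟨(FreeTwo K)ᵐᵒᵖ ∙ f (FreeAlgebra.ι K 0), (FreeTwo K)ᵐᵒᵖ ∙ f (FreeAlgebra.ι K 1),
    ?_, ?_, ?_⟩
  · simpa using h0 0
  · simpa using h0 1
  · refine Submodule.disjoint_def.2 fun x hx hy => ?_
    obtain ⟨a, rfl⟩ := Submodule.mem_span_singleton.1 hx
    obtain ⟨b, hb⟩ := Submodule.mem_span_singleton.1 hy
    rw [← map_smul, ← map_smul] at hb
    have := FreeAlgebra.eq_zero_of_ι_mul_eq_ι_mul zero_ne_one (hf hb).symm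
    rw [(MulOpposite.unop_eq_zero_iff a).1 this, zero_smul]

variable (K) in
theorem not_isUniformModule_left (I : Submodule (FreeTwo K) (FreeTwo K)) :
    ¬ IsUniformModule (FreeTwo K) I := by
  rintro ⟨hI, h⟩
  obtain ⟨a, ha⟩ := exists_ne (0 : I)
  obtain ⟨A, B, hA, hB, hAB⟩ := exists_disjoint_of_injective_left
    (LinearMap.toSpanSingleton (FreeTwo K) I a) fun r s hrs => by
      have : r * (a : FreeTwo K) = s * a := congrArg Subtype.val hrs
      exact mul_right_cancel₀ (fun h0 => ha (Subtype.ext h0)) this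
  exact h A B hA hB hAB.eq_bot

variable (K) in
theorem not_isUniformModule_right (I : Submodule (FreeTwo K)ᵐᵒᵖ (FreeTwo K)) :
    ¬ IsUniformModule (FreeTwo K)ᵐᵒᵖ I := by
  rintro ⟨hI, h⟩
  obtain ⟨a, ha⟩ := exists_ne (0 : I)
  obtain ⟨A, B, hA, hB, hAB⟩ := exists_disjoint_of_injective_right (elementHom a) fun r s hrs =>
    elementHom_injective (fun h0 => ha (Subtype.ext h0)) (congrArg Subtype.val hrs)
  exact h A B hA hB hAB.eq_bot

/-- The initial words of an infinite word `ε` in the two generators. -/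
def branchWord (ε : ℕ → Fin 2) : ℕ → FreeTwo K
  | 0 => 1
  | n + 1 => branchWord ε n * FreeAlgebra.ι K (ε n)

/-- The words that leave the infinite word `ε` with their last letter. -/
def exitWord (ε : ℕ → Fin 2) (n : ℕ) : FreeTwo K := branchWord ε n * FreeAlgebra.ι K (ε n + 1)

theorem branchWord_mul_ι_eq (ε : ℕ → Fin 2) (n : ℕ) (j : Fin 2) :
    ∃ (i : Fin 2) (s : FreeTwo K), branchWord ε n * FreeAlgebra.ι K j = FreeAlgebra.ι K i * s := by
  induction n generalizing j with
  | zero => exact ⟨j, 1, by rw [branchWord, one_mul, mul_one]⟩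
  | succ n ih =>
    obtain ⟨i, s, h⟩ := ih (ε n)
    exact ⟨i, s * FreeAlgebra.ι K j, by rw [branchWord, h, mul_assoc]⟩

/-- The right ideal generated by the words that leave an infinite word is essential. -/
theorem exists_mul_mem_span_exitWord (ε : ℕ → Fin 2) (a : FreeTwo K) :
    ∃ u : FreeTwo K, u ≠ 0 ∧
      a * u ∈ Submodule.span (FreeTwo K)ᵐᵒᵖ (Set.range (exitWord (K := K) ε)) := by
  set D := Submodule.span (FreeTwo K)ᵐᵒᵖ (Set.range (exitWord (K := K) ε)) with hD
  let W : Submonoid (FreeTwo K) := Submonoid.closure (Set.range (FreeAlgebra.ι K))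
  have hDmul : ∀ d ∈ D, ∀ r, d * r ∈ D := fun d hd r => D.smul_mem (.op r) hd
  have hword : ∀ w ∈ W, w ∈ D ∨ ∃ n, w = branchWord ε n := by
    intro w hw
    induction hw using Submonoid.closure_induction_right with
    | one => exact Or.inr ⟨0, rfl⟩
    | mul_right w hw y hy ih =>
      obtain ⟨i, rfl⟩ := hy
      rcases ih with h | ⟨n, rfl⟩
      · exact Or.inl (hDmul _ h _)
      · by_cases hi : i = ε n
        · exact Or.inr ⟨n + 1, by rw [branchWord, hi]⟩
        · have : i = ε n + 1 := by omega
          exact Or.inl (Submodule.subset_span ⟨n, by rw [exitWord, this]⟩)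
  have hne : ∀ w ∈ W, w ≠ 0 := by
    intro w hw
    induction hw using Submonoid.closure_induction_right with
    | one => exact one_ne_zero
    | mul_right w hw y hy ih =>
      obtain ⟨i, rfl⟩ := hy
      exact mul_ne_zero ih (FreeAlgebra.ι_ne_zero i)
  -- The quantifier over `u` makes the property additive in `a`.
  have key : ∀ u ∈ W, ∃ u' ∈ W, a * u * u' ∈ D := by
    have ha : a ∈ Submodule.span K (W : Set (FreeTwo K)) := by
      rw [← Algebra.adjoin_eq_span, FreeAlgebra.adjoin_range_ι]
      trivial
    induction ha using Submodule.span_induction with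
    | zero => exact fun u _ => ⟨1, W.one_mem, by simp⟩
    | mem w hw =>
      intro u hu
      rcases hword _ (W.mul_mem hw hu) with h | ⟨n, h⟩
      · exact ⟨1, W.one_mem, hDmul _ h _⟩
      · exact ⟨FreeAlgebra.ι K (ε n + 1), Submonoid.subset_closure ⟨_, rfl⟩,
          Submodule.subset_span ⟨n, by rw [exitWord, h]⟩⟩
    | add a b _ _ iha ihb =>
      intro u hu
      obtain ⟨s, hs, h1⟩ := iha u hu
      obtain ⟨t, ht, h2⟩ := ihb (u * s) (W.mul_mem hu hs)
      refine ⟨s * t, W.mul_mem hs ht, ?_⟩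
      rw [add_mul, add_mul]
      refine D.add_mem ?_ ?_
      · rw [← mul_assoc]
        exact hDmul _ h1 t
      · rwa [← mul_assoc, mul_assoc b]
    | smul c a _ ih =>
      intro u hu
      obtain ⟨s, hs, h⟩ := ih u hu
      refine ⟨s, hs, ?_⟩
      rw [smul_mul_assoc, smul_mul_assoc, Algebra.smul_def, Algebra.commutes]
      exact hDmul _ h _
  obtain ⟨u, hu, h⟩ := key 1 W.one_mem
  exact ⟨u, hne u hu, by rwa [mul_one] at h⟩

/-- A nonzero element of a module in `Prod(E)` is not annihilated by the essential right ideal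
generated by the words that leave an infinite word. -/
theorem IsInjectiveHull.eq_zero_of_exitWord {E : ModuleCat.{u} (FreeTwo K)ᵐᵒᵖ}
    {j : FreeTwo K →ₗ[(FreeTwo K)ᵐᵒᵖ] E}
    (hj : IsInjectiveHull j) (ε : ℕ → Fin 2)
    {N : ModuleCat.{u} (FreeTwo K)ᵐᵒᵖ} (hN : prodOf E N) {x : N}
    (hx : ∀ n, MulOpposite.op (exitWord ε n : FreeTwo K) • x = 0) : x = 0 := by
  by_contra hx0
  obtain ⟨f, hf⟩ := exists_apply_ne_zero_of_prodOf hN hx0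
  obtain ⟨a, m, hm, ham⟩ := hj.exists_smul_eq hf
  obtain ⟨u, hu, hau⟩ := exists_mul_mem_span_exitWord ε a.unop
  have hle : Submodule.span (FreeTwo K)ᵐᵒᵖ (Set.range (exitWord (K := K) ε)) ≤
      LinearMap.ker (elementHom (R := FreeTwo K) (f x)) := by
    rw [Submodule.span_le]
    rintro _ ⟨n, rfl⟩
    change MulOpposite.op (exitWord ε n : FreeTwo K) • f x = 0
    rw [← map_smul, hx, map_zero]
  have h1 : MulOpposite.op (a.unop * u) • f x = 0 := hle hau
  rw [MulOpposite.op_mul, mul_smul, MulOpposite.op_unop, ham, ← map_smul] at h1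
  have h2 : m * u = 0 := hj.mono (h1.trans (map_zero j).symm)
  exact mul_ne_zero hm hu h2

/-- If `M*` is in `Prod(E)`, then `M = D M` for the right ideal `D` generated by the words leaving
an infinite word: a character of `M` that vanishes on `D M` is annihilated by `D`. -/
theorem IsInjectiveHull.eq_top_of_exitWord {E : ModuleCat.{u} (FreeTwo K)ᵐᵒᵖ}
    {j : FreeTwo K →ₗ[(FreeTwo K)ᵐᵒᵖ] E}
    (hj : IsInjectiveHull j) (ε : ℕ → Fin 2)
    {M : ModuleCat.{u} (FreeTwo K)} (hM : prodOf E (dualModule M)) (S : AddSubgroup M)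
    (hS : ∀ n (m : M), (exitWord ε n : FreeTwo K) • m ∈ S) : S = ⊤ := by
  rw [eq_top_iff]
  intro m _
  by_contra hm
  obtain ⟨c, hc⟩ := CharacterModule.exists_character_apply_ne_zero_of_ne_zero
    (a := (QuotientAddGroup.mk m : M ⧸ S)) (by rwa [Ne, QuotientAddGroup.eq_zero_iff])
  let φ : CharacterModule M := AddMonoidHom.comp c (QuotientAddGroup.mk' S)
  have hφ : φ = 0 := hj.eq_zero_of_exitWord ε hM (x := φ) fun n =>
    CharacterModule.ext _ fun k => by
      change c (QuotientAddGroup.mk ((exitWord ε n : FreeTwo K) • k)) = 0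
      rw [(QuotientAddGroup.eq_zero_iff _).2 (hS n k), map_zero]
  exact hc congr($hφ m)

/-- If `M*` is injective, then `X M + Y M` is a direct sum of copies of `M`. -/
theorem eq_zero_of_sum_ι_smul_eq_zero {M : ModuleCat.{u} (FreeTwo K)}
    [Module.Injective (FreeTwo K)ᵐᵒᵖ (dualModule M)] (y : Fin 2 → M)
    (hy : ∑ i, (FreeAlgebra.ι K i : FreeTwo K) • y i = 0) : y = 0 := by
  by_contra hne
  obtain ⟨i, hi⟩ := Function.ne_iff.1 hne
  obtain ⟨χ, hχ⟩ := CharacterModule.exists_character_apply_ne_zero_of_ne_zero hi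
  -- `χ` is extended from `X R ⊕ Y R`, where it is placed on the `i`-th summand, to `R`.
  let f : (Fin 2 → FreeTwo K) →ₗ[(FreeTwo K)ᵐᵒᵖ] FreeTwo K :=
    ∑ i, (elementHom (FreeAlgebra.ι K i)).comp (LinearMap.proj i)
  have hf : ∀ r, f r = ∑ i, FreeAlgebra.ι K i * r i := fun r => by simp [f, elementHom_apply]
  have hfinj : Function.Injective f := by
    rw [← LinearMap.ker_eq_bot, LinearMap.ker_eq_bot']
    intro r hr
    rw [hf, Fin.sum_univ_two] at hr
    have h0 : r 0 = 0 := FreeAlgebra.eq_zero_of_ι_mul_eq_ι_mul (b := -r 1) zero_ne_one (by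
      rw [mul_neg]; exact eq_neg_of_add_eq_zero_left hr)
    have h1 : r 1 = 0 := FreeAlgebra.eq_zero_of_ι_mul_eq_ι_mul (b := -r 0) one_ne_zero (by
      rw [mul_neg]; exact eq_neg_of_add_eq_zero_right hr)
    ext k
    fin_cases k
    · exact h0
    · exact h1
  obtain ⟨h, hh⟩ := Module.Injective.out f hfinj
    ((elementHom (R := FreeTwo K) (N := dualModule M) χ).comp (LinearMap.proj i))
  let φ : CharacterModule M := h 1
  have hφ : ∀ (k : Fin 2) (m : M), φ ((FreeAlgebra.ι K k : FreeTwo K) • m) =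
      if k = i then χ m else 0 := by
    intro k m
    have h1 : f (Pi.single k 1) = FreeAlgebra.ι K k := by simp [hf, Pi.single_apply]
    have h2 := hh (Pi.single k 1)
    rw [h1, ← map_op_smul_one] at h2
    have h3 : _ = (MulOpposite.op ((Pi.single k 1 : Fin 2 → FreeTwo K) i) • χ) m :=
      congrArg (fun ψ : CharacterModule M => ψ m) h2
    refine h3.trans ?_
    by_cases hk : k = i
    · subst hk
      rw [Pi.single_eq_same, if_pos rfl, MulOpposite.op_one, one_smul]
    · rw [Pi.single_eq_of_ne (Ne.symm hk), if_neg hk, MulOpposite.op_zero, zero_smul]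
      rfl
  have := congrArg φ hy
  rw [map_sum, map_zero, Finset.sum_congr rfl fun k _ => hφ k (y k)] at this
  simp at this
  exact hχ this

/-- The dual of a nonzero left module is never in `Prod(E)`, for `E` an injective hull of the
regular right module. If `M*` is in `Prod(E)`, then `M = X M ⊕ Y M` with `M ≅ X M ≅ Y M`. Reading
off coordinates repeatedly, a nonzero element `m` of `M` has a nonzero coordinate at every initial
word of some infinite word `ε`. But `M = D M` for the essential right ideal `D` generated by
the words leaving `ε`, so that almost all of these coordinates have to vanish. -/
theorem IsInjectiveHull.subsingleton_of_prodOf_dualModule {E : ModuleCat.{u} (FreeTwo K)ᵐᵒᵖ}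
    {j : FreeTwo K →ₗ[(FreeTwo K)ᵐᵒᵖ] E}
    (hj : IsInjectiveHull j)
    {M : ModuleCat.{u} (FreeTwo K)} (hM : prodOf E (dualModule M)) : Subsingleton M := by
  have := hj.inj
  have := prodOf_injective hM
  let Φ : (Fin 2 → M) →+ M :=
    ∑ i, (DistribSMul.toAddMonoidHom M (FreeAlgebra.ι K i)).comp (Pi.evalAddMonoidHom _ i)
  have hΦ : ∀ y, Φ y = ∑ i, (FreeAlgebra.ι K i : FreeTwo K) • y i := fun y => by simp [Φ]
  have hinj : Function.Injective Φ :=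
    (injective_iff_map_eq_zero Φ).2 fun y hy =>
      eq_zero_of_sum_ι_smul_eq_zero y ((hΦ y).symm.trans hy)
  have hsingle : ∀ i m, Φ (Pi.single i m) = (FreeAlgebra.ι K i : FreeTwo K) • m := fun i m => by
    rw [hΦ, Finset.sum_eq_single i]
    · rw [Pi.single_eq_same]
    · intro k _ hk
      rw [Pi.single_eq_of_ne hk, smul_zero]
    · simp
  have hsurj : Function.Surjective Φ := by
    -- Every nonempty word lies in `X R + Y R`, so any infinite word will do.
    refine AddMonoidHom.range_eq_top.1 (hj.eq_top_of_exitWord 0 hM _ fun n m => ?_)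
    obtain ⟨i, s, h⟩ := branchWord_mul_ι_eq (K := K) 0 n ((0 : ℕ → Fin 2) n + 1)
    exact ⟨Pi.single i (s • m), by rw [hsingle, exitWord, h, mul_smul]⟩
  -- the coordinates of `M = X M ⊕ Y M`
  let c : Fin 2 → M →+ M := fun i =>
    (Pi.evalAddMonoidHom _ i).comp (AddEquiv.ofBijective Φ ⟨hinj, hsurj⟩).symm.toAddMonoidHom
  have hc : ∀ i k m, c i ((FreeAlgebra.ι K k : FreeTwo K) • m) = (Pi.single k m : Fin 2 → M) i := by
    intro i k m
    refine congrFun ((AddEquiv.symm_apply_eq (AddEquiv.ofBijective Φ ⟨hinj, hsurj⟩)).2 ?_) i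
    exact (hsingle k m).symm
  have hc0 : ∀ m, m ≠ 0 → ∃ i, c i m ≠ 0 := by
    intro m hm
    by_contra! h
    refine hm ?_
    have h1 : (AddEquiv.ofBijective Φ ⟨hinj, hsurj⟩).symm m = 0 := funext h
    rwa [map_eq_zero_iff _ (AddEquiv.injective _)] at h1
  by_contra hns
  rw [not_subsingleton_iff_nontrivial] at hns
  obtain ⟨m₀, hm₀⟩ := exists_ne (0 : M)
  choose i hi using hc0
  let path : ℕ → {m : M // m ≠ 0} := fun n =>
    (fun m => ⟨c (i m.1 m.2) m.1, hi m.1 m.2⟩)^[n] ⟨m₀, hm₀⟩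
  let ε : ℕ → Fin 2 := fun n => i (path n).1 (path n).2
  -- `b n` is the coordinate at the word `branchWord ε n`
  let b : ℕ → M →+ M := fun n => Nat.rec (AddMonoidHom.id M) (fun n b => (c (ε n)).comp b) n
  have hb : ∀ n m, b (n + 1) m = c (ε n) (b n m) := fun n m => rfl
  have hbpath : ∀ n, b n m₀ = (path n).1 := by
    intro n
    induction n with
    | zero => rfl
    | succ n ih =>
      rw [hb, ih]
      simp only [path, Function.iterate_succ_apply', ε]
  have hbword : ∀ n m, b n ((branchWord ε n : FreeTwo K) • m) = m := by
    intro n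
    induction n with
    | zero => exact fun m => one_smul _ m
    | succ n ih =>
      intro m
      rw [hb, branchWord, mul_smul, ih, hc, Pi.single_eq_same]
  have hbexit : ∀ k n m, k < n → b n ((exitWord ε k : FreeTwo K) • m) = 0 := by
    intro k n m hkn
    induction n, hkn using Nat.le_induction with
    | base =>
      rw [hb, exitWord, mul_smul, hbword, hc, Pi.single_eq_of_ne (by omega)]
    | succ n _ ih => rw [hb, ih, map_zero]
  -- the elements with almost all coordinates along `ε` equal to zero
  let S : AddSubgroup M :=
    { carrier := {m | ∃ N, ∀ n, N ≤ n → b n m = 0}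
      zero_mem' := ⟨0, fun n _ => map_zero _⟩
      add_mem' := fun {x y} ⟨N, hN⟩ ⟨N', hN'⟩ => ⟨max N N', fun n hn => by
        rw [map_add, hN n ((le_max_left _ _).trans hn), hN' n ((le_max_right _ _).trans hn),
          add_zero]⟩
      neg_mem' := fun {x} ⟨N, hN⟩ => ⟨N, fun n hn => by rw [map_neg, hN n hn, neg_zero]⟩ }
  have hS : S = ⊤ := hj.eq_top_of_exitWord ε hM S fun k m => ⟨k + 1, fun n hn => hbexit k n m hn⟩
  obtain ⟨N, hN⟩ : m₀ ∈ S := hS ▸ trivial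
  exact (path N).2 ((hbpath N).symm.trans (hN N le_rfl))

/-- Injective modules in which every nonzero submodule contains a copy of the free algebra have no
indecomposable direct summands. -/
theorem not_indecomposable_of_retract {Q N : ModuleCat.{v} (FreeTwo K)ᵐᵒᵖ}
    [Module.Injective (FreeTwo K)ᵐᵒᵖ Q]
    (hQ : ∀ L : Submodule (FreeTwo K)ᵐᵒᵖ Q, L ≠ ⊥ →
      ∃ f : FreeTwo K →ₗ[(FreeTwo K)ᵐᵒᵖ] L, Function.Injective f)
    (r : Retract N Q) : ¬ Indecomposable N := by
  intro hN
  have := r.moduleInjective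
  have hi : Function.Injective r.i.hom := (ModuleCat.mono_iff_injective r.i).1 inferInstance
  have hL : LinearMap.range r.i.hom ≠ ⊥ := by
    intro h
    refine hN.1 (ModuleCat.isZero_iff_subsingleton.2 (subsingleton_of_forall_eq 0 fun x => hi ?_))
    rw [map_zero, ← Submodule.mem_bot (FreeTwo K)ᵐᵒᵖ, ← h]
    exact ⟨x, rfl⟩
  obtain ⟨f, hf⟩ := hQ _ hL
  obtain ⟨A, B, hA, hB, hAB⟩ := exists_disjoint_of_injective_right
    ((LinearEquiv.ofInjective r.i.hom hi).symm.toLinearMap.comp f)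
    ((LinearEquiv.ofInjective r.i.hom hi).symm.injective.comp hf)
  exact not_indecomposable_of_disjoint hA hB hAB hN

theorem IsInjectiveHull.not_indecomposable_of_retract_pi {E : ModuleCat.{u} (FreeTwo K)ᵐᵒᵖ}
    {j : FreeTwo K →ₗ[(FreeTwo K)ᵐᵒᵖ] E} (hj : IsInjectiveHull j) {κ : Type v}
    {N : ModuleCat.{max u v} (FreeTwo K)ᵐᵒᵖ}
    (r : Retract N (ModuleCat.of (FreeTwo K)ᵐᵒᵖ (κ → E))) : ¬ Indecomposable N := by
  have := hj.inj
  have : Module.Injective (FreeTwo K)ᵐᵒᵖ (ModuleCat.of (FreeTwo K)ᵐᵒᵖ (κ → E)) :=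
    Module.Injective.pi _ fun _ => E
  exact not_indecomposable_of_retract (fun L hL => exists_injective_hom_of_pi hj hL) r

theorem IsInjectiveHull.not_indecomposable_of_retract {E : ModuleCat.{u} (FreeTwo K)ᵐᵒᵖ}
    {j : FreeTwo K →ₗ[(FreeTwo K)ᵐᵒᵖ] E} (hj : IsInjectiveHull j) {N : ModuleCat.{u} (FreeTwo K)ᵐᵒᵖ}
    (r : Retract N E) :
    ¬ Indecomposable N :=
  hj.not_indecomposable_of_retract_pi (κ := Unit)
    (r.trans (Retract.ofIso (LinearEquiv.funUnique Unit (FreeTwo K)ᵐᵒᵖ E).symm.toModuleIso))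

end FreeAlgebraTwo

end

/-! ### Almost dual pairs and torsion theories over the free algebra -/

theorem mainTheorem10 (K : Type u) [Field K] :
    -- the free algebra is a domain without uniform one-sided ideals
    (IsDomain (FreeAlgebra K (Fin 2)) ∧
      (∀ I : Submodule (FreeAlgebra K (Fin 2)) (FreeAlgebra K (Fin 2)),
        ¬ IsUniformModule (FreeAlgebra K (Fin 2)) I) ∧
      (∀ I : Submodule (FreeAlgebra K (Fin 2))ᵐᵒᵖ (FreeAlgebra K (Fin 2)),
        ¬ IsUniformModule (FreeAlgebra K (Fin 2))ᵐᵒᵖ I)) ∧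
    -- it has an injective hull as a right module over itself
    (∃ (E : ModuleCat.{u} (FreeAlgebra K (Fin 2))ᵐᵒᵖ)
      (j : FreeAlgebra K (Fin 2) →ₗ[(FreeAlgebra K (Fin 2))ᵐᵒᵖ] E), IsInjectiveHull j) ∧
    (∀ (E : ModuleCat.{u} (FreeAlgebra K (Fin 2))ᵐᵒᵖ)
      (j : FreeAlgebra K (Fin 2) →ₗ[(FreeAlgebra K (Fin 2))ᵐᵒᵖ] E), IsInjectiveHull j →
      -- neither the hull nor a product of copies of it has an indecomposable direct summand
      (∀ N : ModuleCat.{u} (FreeAlgebra K (Fin 2))ᵐᵒᵖ,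
        Nonempty (Retract N E) → ¬ Indecomposable N) ∧
      (∀ (ι : Type v) (N : ModuleCat.{max u v} (FreeAlgebra K (Fin 2))ᵐᵒᵖ),
        Nonempty (Retract N (ModuleCat.of (FreeAlgebra K (Fin 2))ᵐᵒᵖ (ι → E))) →
          ¬ Indecomposable N) ∧
      -- nonzero submodules of products of copies of the hull contain copies of the free algebra
      (∀ (ι : Type v) (N : Submodule (FreeAlgebra K (Fin 2))ᵐᵒᵖ (ι → E)), N ≠ ⊥ →
        ∃ f : FreeAlgebra K (Fin 2) →ₗ[(FreeAlgebra K (Fin 2))ᵐᵒᵖ] N, Function.Injective f) ∧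
      -- `(0, Prod(E))` is an almost dual pair
      IsAlmostDualPair (zeroClass (FreeAlgebra K (Fin 2))) (prodOf E) ∧
      -- not squeezed between `Prod(0*)` and `Prod⁺(0*)`, in either order
      ¬ (prodPlusClosure (dualClass (zeroClass (FreeAlgebra K (Fin 2)))) ≤ prodOf E ∧
          prodOf E ≤ prodClosure (dualClass (zeroClass (FreeAlgebra K (Fin 2))))) ∧
      ¬ (prodClosure (dualClass (zeroClass (FreeAlgebra K (Fin 2)))) ≤ prodOf E ∧
          prodOf E ≤ prodPlusClosure (dualClass (zeroClass (FreeAlgebra K (Fin 2))))) ∧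
      prodClosure (dualClass (zeroClass (FreeAlgebra K (Fin 2)))) < pinj (prodOf E) ∧
      -- `Prod(E)` is a `Prod`-closed class of pure-injectives that comes from no class of duals
      -- and from no dual pair
      prodOf E ≤ isPureInjective (FreeAlgebra K (Fin 2)) ∧
      (∀ S : ObjectProperty (ModuleCat.{u} (FreeAlgebra K (Fin 2))),
        prodOf E ≠ prodClosure (dualClass S)) ∧
      (∀ (S : ObjectProperty (ModuleCat.{u} (FreeAlgebra K (Fin 2))))
        (P : ObjectProperty (ModuleCat.{u} (FreeAlgebra K (Fin 2))ᵐᵒᵖ)),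
        IsDualPair S P → prodOf E ≠ pinj P) ∧
      -- the hereditary torsion theory cogenerated by `Prod(E)` comes from no dual pair
      (∃ T : ObjectProperty (FPFunctorCat (FreeAlgebra K (Fin 2))),
        IsHereditaryTorsionTheory T (cogeneratedClass (prodOf E))) ∧
      (∀ (S : ObjectProperty (ModuleCat.{u} (FreeAlgebra K (Fin 2))))
        (P : ObjectProperty (ModuleCat.{u} (FreeAlgebra K (Fin 2))ᵐᵒᵖ)),
        IsDualPair S P → cogeneratedClass (prodOf E) ≠ cogeneratedClass (pinj P))) ∧
    -- hence not every almost dual pair is squeezed, ...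
    ¬ (∀ (S : ObjectProperty (ModuleCat.{u} (FreeAlgebra K (Fin 2))))
        (P : ObjectProperty (ModuleCat.{u} (FreeAlgebra K (Fin 2))ᵐᵒᵖ)),
        IsAlmostDualPair S P →
          prodClosure (dualClass S) ≤ P ∧ P ≤ prodPlusClosure (dualClass S)) ∧
    -- ... not every `Prod`-closed class of pure-injectives arises from a dual pair, ...
    ¬ (∀ P : ObjectProperty (ModuleCat.{u} (FreeAlgebra K (Fin 2))ᵐᵒᵖ),
        P ≤ isPureInjective (FreeAlgebra K (Fin 2)) → P = prodClosure P →
          ∃ (S : ObjectProperty (ModuleCat.{u} (FreeAlgebra K (Fin 2))))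
            (P' : ObjectProperty (ModuleCat.{u} (FreeAlgebra K (Fin 2))ᵐᵒᵖ)),
            IsDualPair S P' ∧ P = pinj P') ∧
    -- ... and not every hereditary torsion theory on the functor category does
    ¬ (∀ T F : ObjectProperty (FPFunctorCat (FreeAlgebra K (Fin 2))),
        IsHereditaryTorsionTheory T F →
          ∃ (S : ObjectProperty (ModuleCat.{u} (FreeAlgebra K (Fin 2))))
            (P : ObjectProperty (ModuleCat.{u} (FreeAlgebra K (Fin 2))ᵐᵒᵖ)),
            IsDualPair S P ∧ F = cogeneratedClass (pinj P)) := by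
  have hdom : IsDomain (FreeAlgebra K (Fin 2)) := inferInstance
  obtain ⟨E₀, j₀, hj₀⟩ :=
    exists_isInjectiveHull (A := (FreeAlgebra K (Fin 2))ᵐᵒᵖ) (FreeAlgebra K (Fin 2))
  have hmain : ∀ (E : ModuleCat.{u} (FreeAlgebra K (Fin 2))ᵐᵒᵖ)
      (j : FreeAlgebra K (Fin 2) →ₗ[(FreeAlgebra K (Fin 2))ᵐᵒᵖ] E), IsInjectiveHull j →
      Module.Injective (FreeAlgebra K (Fin 2))ᵐᵒᵖ E ∧ Nontrivial E ∧
        (∀ M, prodOf E (dualModule M) → Subsingleton M) ∧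
        ¬ prodOf E ≤ prodClosure (dualClass (zeroClass (FreeAlgebra K (Fin 2)))) ∧
        ¬ prodOf E ≤ prodPlusClosure (dualClass (zeroClass (FreeAlgebra K (Fin 2)))) := by
    intro E j hj
    have hE : Nontrivial E := hj.mono.nontrivial
    refine ⟨hj.inj, hE, fun M => hj.subsingleton_of_prodOf_dualModule, fun h => ?_, fun h => ?_⟩
    · exact not_subsingleton E (subsingleton_of_prodClosure
        (subsingleton_of_dualClass subsingleton_of_zeroClass) (h E prodOf_self))
    · exact not_subsingleton E (subsingleton_of_prodPlusClosure
        (subsingleton_of_dualClass subsingleton_of_zeroClass) (h E prodOf_self))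
  obtain ⟨hinj₀, hE₀, hM₀, -, hplus₀⟩ := hmain E₀ j₀ hj₀
  refine ⟨⟨hdom, not_isUniformModule_left K, not_isUniformModule_right K⟩, ⟨E₀, j₀, hj₀⟩,
    ?_, ?_, ?_, ?_⟩
  · intro E j hj
    obtain ⟨hinj, hE, hM, hprod, hplus⟩ := hmain E j hj
    refine ⟨fun N ⟨r⟩ => hj.not_indecomposable_of_retract r,
      fun κ N ⟨r⟩ => hj.not_indecomposable_of_retract_pi r,
      fun κ N hN => exists_injective_hom_of_pi hj hN, isAlmostDualPair_zeroClass hM,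
      fun h => hprod h.2, fun h => hplus h.2, prodClosure_dualClass_zeroClass_lt, ?_,
      prodOf_ne_prodClosure_dualClass hM, ?_,
      ⟨_, FPFunctorCat.isHereditaryTorsionTheory_cogeneratedClass E⟩,
      fun S P hSP => cogeneratedClass_prodOf_ne hM hSP⟩
    · intro M hM
      have := prodOf_injective hM
      exact isPureInjective_of_injective
    · intro S P hSP h
      exact prodOf_ne_prodClosure_dualClass hM S (h.trans hSP.2.symm)
  · exact fun h => hplus₀ (h _ _ (isAlmostDualPair_zeroClass hM₀)).2
  · intro h
    obtain ⟨S, P, hSP, heq⟩ := h (prodOf E₀)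
      (fun M hM => have := prodOf_injective hM; isPureInjective_of_injective)
      (prodClosure_idem _).symm
    exact prodOf_ne_prodClosure_dualClass hM₀ S (heq.trans hSP.2.symm)
  · intro h
    obtain ⟨S, P, hSP, heq⟩ :=
      h _ _ (FPFunctorCat.isHereditaryTorsionTheory_cogeneratedClass E₀)
    exact cogeneratedClass_prodOf_ne hM₀ hSP heq
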